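/- Let $\phi:\mathbb{R}\to[0,\infty)$ be convex and classification-calibrated, i.e. for every $q\in[0,1]$ with $q\ne\frac12$, writing $C_q(a)=q\,\phi(a)+(1-q)\,\phi(-a)$, $$\inf_{a\in\mathbb{R}}C_q(a)\;<\;\inf_{a:\,a(2q-1)\le 0}C_q(a),$$ and suppose that $\phi$ is integrable with respect to every Gaussian measure on $\mathbb{R}$ (so that all surrogate risks below are finite). Let $\sigma>0$, $0<C\le M$ and $\tau>0$. Then there is an $N$, depending only on $\phi,\sigma,C,M,\tau$, such that the following holds for all $d$, all $k$ with $d-k\ge N$, and all $w^*\in\mathbb{R}^d$ with exactly $k$ nonzero coordinates and $C\le\|w^*\|_2\le M$. Let $(x,y)\in\mathbb{R}^d\times\{-1,1\}$ have the law with $P(y=1)=P(y=-1)=\frac12$ and $x\mid y\sim\mathcal N(y\,w^*,D)$, where $D$ is diagonal with $D_{ii}=\sigma^2$ if $w^*_i\neq0$ and $D_{ii}=0$ otherwise. Let $\mathrm{sign}(a)=1$ if $a>0$ and $-1$ otherwise, let $\ell_{0-1}(a,y)=1$ if $\mathrm{sign}(a)\ne y$ and $0$ otherwise, and for $w\in\mathbb{R}^d$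 let $f_w(x)=w^Tx$. Put $R(f_w)=\mathbb{E}[\phi(y\,w^Tx)]$, $R_{0-1}(f)=\mathbb{E}[\ell_{0-1}(f(x),y)]$, $R^*_{0-1}=\inf_f R_{0-1}(f)$ over all measurable $f$ (the Bayes risk), $g(x)=\mathrm{sign}(x^Tw^*)$, and $$R_{adv,0-1}^{\epsilon}(f)=\mathbb{E}\Big[\max_{\|\delta\|_\infty\le\epsilon,\ g(x)=g(x+\delta)}\ell_{0-1}(f(x+\delta),g(x))-\ell_{0-1}(f(x),g(x))\Big].$$ Then $w\mapsto R(f_w)$ is differentiable, and gradient descent $w^{t+1}=w^t-\eta\nabla R(f_{w^t})$ with sufficiently small constant step size $\eta>0$ converges: for every initial point $w^0$ there is a point $\hat w_{GD}(w^0)$ such that for every $B$ there is $\eta_0>0$ with $w^t\to\hat w_{GD}(w^0)$ for all $0<\eta<\eta_0$ and all $\|w^0\|_2\le B$. If $w^0\sim\mathcal N\big(0,\tfrac1{\sqrt{d-k}}I_d\big)$, then with probability at least $1-\tau$ the limit has zero excess $0/1$ risk but large adversarial risk: $$R_{0-1}(f_{\hat w_{GD}})-R^*_{0-1}=0\quad\text{and}\quad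 R_{adv,0-1}^{\epsilon}(f_{\hat w_{GD}})\ge0.95\ \text{ for all }\ \epsilon\ge\frac{2\|w^*\|_2^2}{\sqrt{d-k}}.$$ -/

import Mathlib

noncomputable section

namespace AdvRisk

open MeasureTheory ProbabilityTheory

/-- `ℝ^d` with the Euclidean inner product. -/
abbrev Vec (d : ℕ) : Type := EuclideanSpace ℝ (Fin d)

/-- `sgn a = 1` if `a > 0` and `-1` otherwise. -/
def sgn (a : ℝ) : ℝ := if 0 < a then 1 else -1

/-- The 0/1 loss of the score `a` for the label `y`. -/
def zeroOneLoss (a y : ℝ) : ℝ := if sgn a ≠ y then 1 else 0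

/-- The linear classifier `x ↦ wᵀ x`. -/
def lin {d : ℕ} (w : Vec d) : Vec d → ℝ := fun x => inner ℝ w x

/-- The 0/1 risk of a score based classifier under a law `P` of pairs (covariate, label). -/
def risk01 {d : ℕ} (P : Measure (Vec d × ℝ)) (f : Vec d → ℝ) : ℝ :=
  ∫ p, zeroOneLoss (f p.1) p.2 ∂P

/-- The Bayes risk: the infimum of the 0/1 risk over all measurable classifiers. -/
def bayesRisk {d : ℕ} (P : Measure (Vec d × ℝ)) : ℝ :=
  ⨅ f : {f : Vec d → ℝ // Measurable f}, risk01 P f.1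

/-- The adversarial 0/1 risk of `f` with respect to the base classifier `g` and the optimal
adversary with `L∞` budget `ε`: the expectation of the maximum of
`ℓ₀₁ (f (x + δ), g x) - ℓ₀₁ (f x, g x)` over all `δ` with `‖δ‖_∞ ≤ ε` and `g x = g (x + δ)`. The set
under the supremum is finite, being contained in `{-1, 0, 1}`. -/
def advRisk01 {d : ℕ} (P : Measure (Vec d × ℝ)) (g : Vec d → ℝ) (ε : ℝ) (f : Vec d → ℝ) : ℝ :=
  ∫ p, sSup {v : ℝ | ∃ δ : Vec d, (∀ i, |δ i| ≤ ε) ∧ g p.1 = g (p.1 + δ) ∧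
    v = zeroOneLoss (f (p.1 + δ)) (g p.1) - zeroOneLoss (f p.1) (g p.1)} ∂P

/-- The risk `R(f_w)` of the linear classifier `w` for the loss `φ (y wᵀ x)`. -/
def surrogateRisk {d : ℕ} (P : Measure (Vec d × ℝ)) (φ : ℝ → ℝ) (w : Vec d) : ℝ :=
  ∫ p, φ (p.2 * lin w p.1) ∂P

/-- The iterates `w₀, w₁, w₂, …` of gradient descent on `R` with constant step size `η`. -/
def gradDescent {d : ℕ} (R : Vec d → ℝ) (η : ℝ) (w₀ : Vec d) : ℕ → Vec d
  | 0 => w₀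
  | t + 1 => gradDescent R η w₀ t - η • gradient R (gradDescent R η w₀ t)

/-- The conditional `φ`-risk of the score `a` at a point where the label is `1` with
probability `q`. -/
def condRisk (φ : ℝ → ℝ) (q a : ℝ) : ℝ := q * φ a + (1 - q) * φ (-a)

/-- Classification calibration: unless `q = 1/2`, scores whose sign disagrees with the Bayes decision
do not attain (even in the limit) the least conditional `φ`-risk.
It is used for nonnegative `φ`, so that the infima are over sets that are bounded below. -/
def IsCalibrated (φ : ℝ → ℝ) : Prop :=
  ∀ q : ℝ, 0 ≤ q → q ≤ 1 → q ≠ 1 / 2 →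
    (⨅ a : ℝ, condRisk φ q a) < ⨅ a : {a : ℝ // a * (2 * q - 1) ≤ 0}, condRisk φ q a.1

/-- The covariance of the data given the label: diagonal, with entry `σ²` at the coordinates
where `wstar` does not vanish and `0` elsewhere. -/
def dataCov {d : ℕ} (wstar : Vec d) (σ : ℝ) : Matrix (Fin d) (Fin d) ℝ :=
  Matrix.diagonal fun i => if wstar i ≠ 0 then σ ^ 2 else 0

/-- The law of `(x, y)`: `y = 1` and `y = -1` with probability `1/2` each, and
`x | y ∼ N (y wstar, dataCov wstar σ)`. -/
def dataLaw {d : ℕ} (wstar : Vec d) (σ : ℝ) : Measure (Vec d × ℝ) :=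
  (2⁻¹ : ENNReal) • (multivariateGaussian wstar (dataCov wstar σ)).prod (Measure.dirac (1 : ℝ)) +
  (2⁻¹ : ENNReal) •
    (multivariateGaussian (-wstar) (dataCov wstar σ)).prod (Measure.dirac (-1 : ℝ))

/-- The number `‖w‖₀` of nonzero coordinates. -/
def nnz {d : ℕ} (w : Vec d) : ℕ := {i : Fin d | w i ≠ 0}.ncard

/-- The law `N (0, (d - k)^(-1/2) I_d)` of the random initialization, where `m = d - k`. -/
def initLaw (d m : ℕ) : Measure (Vec d) :=
  multivariateGaussian 0 ((1 / Real.sqrt m) • (1 : Matrix (Fin d) (Fin d) ℝ))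

end AdvRisk

end

noncomputable section

namespace AdvRisk

open MeasureTheory ProbabilityTheory Filter Topology

/-! The data are carried by the support of `wstar`. Let P be the projection `suppProj wstar`. The
margin of w is normal with mean ⟨w, w*⟩ and standard deviation σ‖P w‖, so the surrogate risk is
`gaussAvg φ` at these two numbers and depends on P w alone. Gradient descent therefore never moves
the part ξ of the initialization off the support.

On the range of P the minimizer is unique. For a fixed mean, a larger deviation strictly increases
the risk (`gaussAvg_lt_gaussAvg`), so only multiples of `wstar` compete. Calibration makes φ
differentiable at 0 with slope p < 0 (`exists_isConvexLoss`), and this gives exactly one minimizer c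
on the ray, with c > 0 (`exists_ray_min`). Although φ may have kinks, Gaussian averaging makes the
risk smooth wherever P w ≠ 0 (`contDiffAt_gaussAvg`). This suffices for convergence to c w* + ξ
(`tendsto_gradDescent`).

On the data ξ contributes nothing, so the limit classifies as `wstar` does, which is Bayes optimal
(`risk01_lin_le`). An adversary, however, can shift ξᵀx by ε‖ξ‖₁ without affecting the base
classifier. With m = d - k, the m coordinates of ξ have standard deviation m^(-1/4), so ‖ξ‖₁ is of
order m^(3/4) and the shift is at least of order m^(1/4). Meanwhile the score c w*ᵀx has a second
moment bounded independently of d: the linear growth of φ on the negative side bounds c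
(`le_of_ray_le`). Chebyshev's inequality then yields 0.95 (`le_advRisk01`), and an exponential
Markov bound controls the initialization (`initLaw_real_sum_abs_le`). -/

/-! ### Convex calibrated losses -/

/-- A nonnegative convex function that is integrable for all Gaussian measures on the line and
has negative derivative `p` at the origin. -/
structure IsConvexLoss (φ : ℝ → ℝ) (p : ℝ) : Prop where
  nonneg : ∀ t, 0 ≤ φ t
  convex : ConvexOn ℝ Set.univ φ
  integrable : ∀ (μ : ℝ) (v : NNReal), Integrable φ (gaussianReal μ v)
  hasDerivAt : HasDerivAt φ p 0
  deriv_neg : p < 0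

lemma ConvexOn.le_of_hasDerivWithinAt_Ioi {φ : ℝ → ℝ} (hφ : ConvexOn ℝ Set.univ φ) {x q : ℝ}
    (hq : HasDerivWithinAt φ q (Set.Ioi x) x) {a : ℝ} (ha : x < a) :
    φ x + q * (a - x) ≤ φ a := by
  have h := hφ.le_slope_of_hasDerivWithinAt_Ioi (Set.mem_univ _) (Set.mem_univ _) ha hq
  rw [slope_def_field, le_div_iff₀ (by linarith)] at h
  linarith

lemma ConvexOn.le_of_hasDerivWithinAt_Iio {φ : ℝ → ℝ} (hφ : ConvexOn ℝ Set.univ φ) {x q : ℝ}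
    (hq : HasDerivWithinAt φ q (Set.Iio x) x) {a : ℝ} (ha : a < x) :
    φ x + q * (a - x) ≤ φ a := by
  have h := hφ.slope_le_of_hasDerivWithinAt_Iio (Set.mem_univ _) (Set.mem_univ _) ha hq
  rw [slope_def_field, div_le_iff₀ (by linarith)] at h
  linarith

lemma ConvexOn.exists_subgradient {φ : ℝ → ℝ} (hφ : ConvexOn ℝ Set.univ φ) (x : ℝ) :
    ∃ q, ∀ t, φ x + q * (t - x) ≤ φ t := by
  have hx : x ∈ interior (Set.univ : Set ℝ) := by simp
  refine ⟨derivWithin φ (Set.Ioi x) x, fun t => ?_⟩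
  rcases lt_trichotomy t x with h | h | h
  · have h1 := ConvexOn.le_of_hasDerivWithinAt_Iio hφ
      (hφ.hasDerivWithinAt_leftDeriv_of_mem_interior hx) h
    have h2 := hφ.leftDeriv_le_rightDeriv_of_mem_interior hx
    nlinarith
  · simp [h]
  · exact ConvexOn.le_of_hasDerivWithinAt_Ioi hφ
      (hφ.hasDerivWithinAt_rightDeriv_of_mem_interior hx) h

/-- The score 0 competes in the infimum over wrong signs, with value φ 0. If no positive score did
better, the two infima in the definition of calibration would agree. -/
lemma IsCalibrated.exists_condRisk_lt {φ : ℝ → ℝ} (hn : ∀ t, 0 ≤ φ t) (hc : IsCalibrated φ)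
    {q : ℝ} (hq : 1 / 2 < q) (hq1 : q ≤ 1) : ∃ a > 0, condRisk φ q a < φ 0 := by
  by_contra! h
  have hbd : ∀ a, 0 ≤ condRisk φ q a := fun a =>
    add_nonneg (mul_nonneg (by linarith) (hn _)) (mul_nonneg (by linarith) (hn _))
  have hlt := hc q (by linarith) hq1 hq.ne'
  have hbdd : BddBelow (Set.range fun a : {a : ℝ // a * (2 * q - 1) ≤ 0} => condRisk φ q a.1) :=
    ⟨0, by rintro _ ⟨a, rfl⟩; exact hbd _⟩
  refine absurd hlt (not_lt.2 (le_ciInf fun a => ?_))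
  rcases le_or_gt a 0 with ha | ha
  · exact ciInf_le hbdd ⟨a, mul_nonpos_of_nonpos_of_nonneg ha (by linarith)⟩
  · refine (ciInf_le hbdd ⟨0, by simp⟩).trans (le_trans (le_of_eq ?_) (h a ha))
    simp only [condRisk, neg_zero]; ring

/-- With one-sided derivatives l ≤ r at 0, the supporting lines give C_q(a) ≥ φ 0 + a (q r - (1 - q)
l) for a > 0, so calibration makes the bracket negative for q > 1/2. Letting q → 1/2 yields r ≤ l,
hence differentiability; q = 1 yields r < 0. -/
lemma IsCalibrated.exists_isConvexLoss {φ : ℝ → ℝ} (hn : ∀ t, 0 ≤ φ t)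
    (hconv : ConvexOn ℝ Set.univ φ) (hc : IsCalibrated φ)
    (hint : ∀ (μ : ℝ) (v : NNReal), Integrable φ (gaussianReal μ v)) :
    ∃ p, IsConvexLoss φ p := by
  have h0 : (0 : ℝ) ∈ interior (Set.univ : Set ℝ) := by simp
  set r := derivWithin φ (Set.Ioi 0) 0
  set l := derivWithin φ (Set.Iio 0) 0
  have hr : HasDerivWithinAt φ r (Set.Ioi 0) 0 := hconv.hasDerivWithinAt_rightDeriv_of_mem_interior h0
  have hl : HasDerivWithinAt φ l (Set.Iio 0) 0 := hconv.hasDerivWithinAt_leftDeriv_of_mem_interior h0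
  have hlr : l ≤ r := hconv.leftDeriv_le_rightDeriv_of_mem_interior h0
  have key : ∀ q, 1 / 2 < q → q ≤ 1 → q * r - (1 - q) * l < 0 := by
    intro q hq hq1
    obtain ⟨a, ha, hlt⟩ := hc.exists_condRisk_lt hn hq hq1
    have h1 := ConvexOn.le_of_hasDerivWithinAt_Ioi hconv hr ha
    have h2 := ConvexOn.le_of_hasDerivWithinAt_Iio hconv hl (neg_lt_zero.2 ha)
    simp only [sub_zero] at h1 h2
    unfold condRisk at hlt
    have h3 := mul_le_mul_of_nonneg_left h1 (by linarith : 0 ≤ q)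
    have h4 := mul_le_mul_of_nonneg_left h2 (by linarith : 0 ≤ 1 - q)
    by_contra! hge
    nlinarith [mul_nonneg hge ha.le]
  have hle : r ≤ l := by
    have ht : Tendsto (fun q : ℝ => q * r - (1 - q) * l) (𝓝[>] (1 / 2))
        (𝓝 ((1 / 2) * r - (1 - 1 / 2) * l)) :=
      (Continuous.tendsto (by fun_prop) _).mono_left nhdsWithin_le_nhds
    have := le_of_tendsto ht (b := 0) (by
      filter_upwards [Ioc_mem_nhdsGT (show (1 / 2 : ℝ) < 1 by norm_num)] with q hq
      exact (key q hq.1 hq.2).le)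
    linarith
  have hEq : l = r := le_antisymm hlr hle
  refine ⟨r, hn, hconv, hint, ?_, ?_⟩
  · rw [← hasDerivWithinAt_univ, ← Set.Iic_union_Ici (a := (0 : ℝ))]
    exact (hEq ▸ hl.Iic_of_Iio).union hr.Ici_of_Ioi
  · have := key 1 (by norm_num) le_rfl
    linarith

/-! ### Gaussian averages of the loss -/

/-- The mean of `φ` under the normal law with mean `m` and standard deviation `s`. -/
def gaussAvg (φ : ℝ → ℝ) (m s : ℝ) : ℝ := ∫ z, φ (m + s * z) ∂gaussianReal 0 1

lemma gaussianReal_map_affine (m s : ℝ) :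
    (gaussianReal 0 1).map (fun z => m + s * z) = gaussianReal m (.mk (s ^ 2) (sq_nonneg s)) := by
  have : (fun z : ℝ => m + s * z) = (fun z => m + z) ∘ (fun z => s * z) := rfl
  rw [this, ← Measure.map_map (by fun_prop) (by fun_prop), gaussianReal_map_const_mul,
    gaussianReal_map_const_add]
  simp

/-- The Gaussian and Lebesgue measures have the same null sets, so continuity upgrades almost
everywhere to everywhere. All strictness statements below rest on this. -/
lemma eq_zero_of_gaussian_integral_nonpos {f : ℝ → ℝ} (hf : Continuous f) (hn : ∀ z, 0 ≤ f z)
    (hi : Integrable f (gaussianReal 0 1)) (h0 : ∫ z, f z ∂gaussianReal 0 1 ≤ 0) (z : ℝ) :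
    f z = 0 := by
  have h1 : ∫ z, f z ∂gaussianReal 0 1 = 0 := le_antisymm h0 (integral_nonneg hn)
  rw [integral_eq_zero_iff_of_nonneg hn hi] at h1
  have h2 : f =ᵐ[volume] 0 := (gaussianReal_absolutelyContinuous' 0 one_ne_zero).ae_eq h1
  exact congrFun ((hf.ae_eq_iff_eq _ continuous_const).1 h2) z

namespace IsConvexLoss

variable {φ : ℝ → ℝ} {p : ℝ}

lemma continuous (h : IsConvexLoss φ p) : Continuous φ := h.convex.locallyLipschitz.continuous

lemma tangent_le (h : IsConvexLoss φ p) (t : ℝ) : φ 0 + p * t ≤ φ t := by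
  rcases lt_trichotomy t 0 with ht | ht | ht
  · simpa using ConvexOn.le_of_hasDerivWithinAt_Iio h.convex h.hasDerivAt.hasDerivWithinAt ht
  · simp [ht]
  · simpa using ConvexOn.le_of_hasDerivWithinAt_Ioi h.convex h.hasDerivAt.hasDerivWithinAt ht

lemma integrable_affine (h : IsConvexLoss φ p) (m s : ℝ) :
    Integrable (fun z => φ (m + s * z)) (gaussianReal 0 1) := by
  have := h.integrable m (.mk (s ^ 2) (sq_nonneg s))
  rw [← gaussianReal_map_affine] at this
  exact this.comp_measurable (by fun_prop)

end IsConvexLoss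

lemma integral_gaussianReal_eq_gaussAvg {φ : ℝ → ℝ} (hφ : Continuous φ) (m s : ℝ) :
    ∫ t, φ t ∂gaussianReal m (.mk (s ^ 2) (sq_nonneg s)) = gaussAvg φ m s := by
  rw [← gaussianReal_map_affine, integral_map (by fun_prop) hφ.aestronglyMeasurable, gaussAvg]

lemma gaussAvg_zero_right (φ : ℝ → ℝ) (m : ℝ) : gaussAvg φ m 0 = φ m := by
  simp [gaussAvg]

lemma integrable_id_stdNormal : Integrable (fun z : ℝ => z) (gaussianReal 0 1) :=
  (memLp_id_gaussianReal 1).integrable le_rfl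

lemma integral_affine_stdNormal (m s : ℝ) : ∫ z, (m + s * z) ∂gaussianReal 0 1 = m := by
  rw [integral_add (by fun_prop) (integrable_id_stdNormal.const_mul s), integral_const_mul,
    integral_id_gaussianReal]
  simp

namespace IsConvexLoss

variable {φ : ℝ → ℝ} {p : ℝ}

/-- The slope would be p < 0, and the line would become negative far to the right. -/
lemma not_affine (h : IsConvexLoss φ p) (b q : ℝ) : ¬ ∀ t, φ t = b + q * t := by
  intro hE
  have hd : HasDerivAt φ q 0 := by
    rw [show φ = fun t => b + q * t from funext hE]
    simpa using ((hasDerivAt_id (0 : ℝ)).const_mul q).const_add b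
  have hq : q = p := hd.unique h.hasDerivAt
  have hp := h.deriv_neg
  have h1 := h.nonneg ((b + 1) / (-p))
  rw [hE, hq, mul_div_assoc', div_neg, mul_div_cancel_left₀ _ hp.ne] at h1
  linarith

/-- Jensen's inequality is strict although φ need not be strictly convex: equality would force φ to
coincide with its supporting line at m on all of ℝ. -/
lemma lt_gaussAvg (h : IsConvexLoss φ p) (m : ℝ) {s : ℝ} (hs : s ≠ 0) : φ m < gaussAvg φ m s := by
  by_contra! hle
  obtain ⟨q, hq⟩ := ConvexOn.exists_subgradient h.convex m
  have hi := h.integrable_affine m s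
  have hlin : Integrable (fun z : ℝ => φ m + q * s * z) (gaussianReal 0 1) :=
    (integrable_const _).add (integrable_id_stdNormal.const_mul _)
  have hz := eq_zero_of_gaussian_integral_nonpos
    (f := fun z => φ (m + s * z) - (φ m + q * s * z))
    ((h.continuous.comp (by fun_prop)).sub (by fun_prop))
    (fun z => by have := hq (m + s * z); ring_nf at this ⊢; linarith)
    (hi.sub hlin) (by
      rw [integral_sub hi hlin, integral_affine_stdNormal]
      exact sub_nonpos.2 hle)
  refine h.not_affine (φ m - q * m) q fun t => ?_
  have := hz ((t - m) / s)
  rw [mul_assoc, mul_div_cancel₀ _ hs] at this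
  rw [add_sub_cancel] at this
  linarith

lemma convexOn_gaussAvg (h : IsConvexLoss φ p) :
    ConvexOn ℝ Set.univ (fun x : ℝ × ℝ => gaussAvg φ x.1 x.2) := by
  refine ⟨convex_univ, fun x _ y _ a b ha hb hab => ?_⟩
  have h1 := h.integrable_affine x.1 x.2
  have h2 := h.integrable_affine y.1 y.2
  simp only [gaussAvg, smul_eq_mul]
  rw [← integral_const_mul, ← integral_const_mul, ← integral_add (h1.const_mul a) (h2.const_mul b)]
  refine integral_mono (h.integrable_affine _ _) ((h1.const_mul a).add (h2.const_mul b)) fun z => ?_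
  have := h.convex.2 (Set.mem_univ (x.1 + x.2 * z)) (Set.mem_univ (y.1 + y.2 * z)) ha hb hab
  simp only [smul_eq_mul] at this
  refine le_trans (le_of_eq ?_) this
  congr 1
  simp; ring

/-- In s the average is convex and exceeds its value at s = 0 strictly, by `lt_gaussAvg`;
interpolating between 0 and s gives the claim. -/
lemma gaussAvg_lt_gaussAvg (h : IsConvexLoss φ p) (m : ℝ) {s s' : ℝ} (hs' : 0 ≤ s')
    (hs : s' < s) : gaussAvg φ m s' < gaussAvg φ m s := by
  have hs0 : 0 < s := hs'.trans_lt hs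
  have h1 := h.lt_gaussAvg m hs0.ne'
  have h2 := h.convexOn_gaussAvg.2 (Set.mem_univ (m, 0)) (Set.mem_univ (m, s))
    (show 0 ≤ 1 - s' / s from sub_nonneg.2 ((div_le_one hs0).2 hs.le))
    (show 0 ≤ s' / s by positivity) (by ring)
  simp only [Prod.smul_mk, Prod.mk_add_mk, smul_eq_mul, mul_zero, zero_add,
    div_mul_cancel₀ _ hs0.ne', gaussAvg_zero_right] at h2
  rw [show (1 - s' / s) * m + s' / s * m = m by ring] at h2
  have h3 : s' / s < 1 := (div_lt_one hs0).2 hs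
  nlinarith

/-! ### The remainder of `φ` at the origin -/

lemma remainder_tendsto (h : IsConvexLoss φ p) (H : ℝ) :
    Tendsto (fun ρ : ℝ => (φ (ρ * H) - φ 0 - p * (ρ * H)) / ρ) (𝓝[>] 0) (𝓝 0) := by
  have h1 : HasDerivAt (fun ρ : ℝ => φ (ρ * H) - φ 0 - p * (ρ * H)) 0 0 := by
    have h2 : HasDerivAt (fun ρ : ℝ => ρ * H) H 0 := by simpa using (hasDerivAt_id (0:ℝ)).mul_const H
    have h3 : HasDerivAt (fun ρ : ℝ => φ (ρ * H)) (p * H) 0 :=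
      HasDerivAt.comp (0 : ℝ) (h₂ := φ) (by simpa using h.hasDerivAt) h2
    have h4 := (h3.sub_const (φ 0)).sub (h2.const_mul p)
    rw [sub_self] at h4
    exact h4
  have := (hasDerivAt_iff_tendsto_slope.1 h1).mono_left
    (nhdsWithin_mono (0 : ℝ) (fun x (hx : 0 < x) => hx.ne'))
  refine this.congr fun x => ?_
  simp [slope_def_field]

/-- Difference quotients of a convex function are monotone. The value at ρ = 1 serves as the
dominating function in `tendsto_integral_remainder`. -/
lemma remainder_div_le (h : IsConvexLoss φ p) (H : ℝ) {ρ : ℝ} (h0 : 0 < ρ) (h1 : ρ ≤ 1) :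
    (φ (ρ * H) - φ 0 - p * (ρ * H)) / ρ ≤ φ H - φ 0 - p * H := by
  have := h.convex.2 (Set.mem_univ 0) (Set.mem_univ H) (show 0 ≤ 1 - ρ by linarith) h0.le
    (by ring)
  simp only [smul_eq_mul, mul_zero, zero_add] at this
  rw [div_le_iff₀ h0]
  nlinarith

/-- The remainder is convex, so on [-T, T] it is largest at an endpoint; both endpoint values are
nonnegative, so their sum is a bound. -/
lemma remainder_le (h : IsConvexLoss φ p) {t T : ℝ} (ht : |t| ≤ T) :
    φ t - φ 0 - p * t ≤ (φ T - φ 0 - p * T) + (φ (-T) - φ 0 - p * (-T)) := by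
  have hT : 0 ≤ T := (abs_nonneg t).trans ht
  have e1 := h.tangent_le T
  have e2 := h.tangent_le (-T)
  have hconv : ConvexOn ℝ Set.univ (fun t => φ t - φ 0 - p * t) := by
    have := (h.convex.add_const (-φ 0)).sub ((LinearMap.concaveOn (p • LinearMap.id) convex_univ))
    refine this.congr fun x _ => by simp; ring
  have h2 := hconv.le_on_segment (Set.mem_univ (-T)) (Set.mem_univ T) (z := t)
    (by rw [segment_eq_Icc (by linarith)]; exact abs_le.1 ht)
  refine h2.trans (max_le ?_ ?_) <;> linarith

lemma integrable_abs_affine (h : IsConvexLoss φ p) (m s : ℝ) :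
    Integrable (fun z => φ (m + s * |z|)) (gaussianReal 0 1) := by
  refine ((h.integrable_affine m s).add (h.integrable_affine m (-s))).mono'
    (h.continuous.comp (by fun_prop)).aestronglyMeasurable (ae_of_all _ fun z => ?_)
  rw [Real.norm_eq_abs, abs_of_nonneg (h.nonneg _)]
  simp only [Pi.add_apply]
  rcases abs_choice z with hz | hz <;> rw [hz]
  · linarith [h.nonneg (m + -s * z)]
  · rw [show m + s * -z = m + -s * z by ring]
    linarith [h.nonneg (m + s * z)]

lemma integrable_remainder (h : IsConvexLoss φ p) (ρ : ℝ) :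
    Integrable (fun z => φ (ρ * (1 + |z|)) - φ 0 - p * (ρ * (1 + |z|))) (gaussianReal 0 1) := by
  have h1 := h.integrable_abs_affine ρ ρ
  have h2 : Integrable (fun z : ℝ => p * (ρ * (1 + |z|))) (gaussianReal 0 1) :=
    (((integrable_const (1 : ℝ)).add integrable_id_stdNormal.abs).const_mul ρ).const_mul p
  refine Integrable.sub (Integrable.sub ?_ (integrable_const _)) h2
  simpa [mul_add] using h1

lemma tendsto_integral_remainder (h : IsConvexLoss φ p) (H : ℝ → ℝ) (hH : Continuous H)
    (hi : Integrable (fun z => φ (H z) - φ 0 - p * H z) (gaussianReal 0 1)) :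
    Tendsto (fun ρ : ℝ => ∫ z, (φ (ρ * H z) - φ 0 - p * (ρ * H z)) / ρ ∂gaussianReal 0 1)
      (𝓝[>] 0) (𝓝 0) := by
  have hc := h.continuous
  have hdom := tendsto_integral_filter_of_dominated_convergence (μ := gaussianReal 0 1)
    (l := 𝓝[>] (0 : ℝ)) (F := fun ρ z => (φ (ρ * H z) - φ 0 - p * (ρ * H z)) / ρ)
    (f := fun _ => 0) (fun z => φ (H z) - φ 0 - p * H z) ?_ ?_ hi ?_
  · simpa using hdom
  · refine Eventually.of_forall fun ρ => Continuous.aestronglyMeasurable (by fun_prop)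
  · filter_upwards [Ioc_mem_nhdsGT (show (0 : ℝ) < 1 by norm_num)] with ρ hρ
    refine ae_of_all _ fun z => ?_
    rw [Real.norm_eq_abs, abs_of_nonneg]
    · exact h.remainder_div_le _ hρ.1 hρ.2
    · have := h.tangent_le (ρ * H z)
      exact div_nonneg (by linarith) hρ.1.le
  · exact ae_of_all _ fun z => h.remainder_tendsto (H z)

/-- `gaussAvg φ` is differentiable at the origin, where its variance degenerates. -/
lemma hasFDerivAt_gaussAvg_zero (h : IsConvexLoss φ p) :
    HasFDerivAt (fun x : ℝ × ℝ => gaussAvg φ x.1 x.2) (p • ContinuousLinearMap.fst ℝ ℝ ℝ) 0 := by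
  have hc := h.continuous
  -- In the sup norm |x.1 + x.2 z| ≤ ‖x‖ (1 + |z|), so by `remainder_le` the remainders at ±‖x‖ (1 +
  -- |z|) control all directions x at once.
  have hlim := (h.tendsto_integral_remainder (fun z => 1 + |z|) (by fun_prop)
      (by simpa using h.integrable_remainder 1)).add
    (h.tendsto_integral_remainder (fun z => -(1 + |z|)) (by fun_prop)
      (by simpa using h.integrable_remainder (-1)))
  rw [add_zero] at hlim
  rw [hasFDerivAt_iff_isLittleO_nhds_zero, Asymptotics.isLittleO_iff]
  intro c hc0
  have hev := hlim.eventually (Iio_mem_nhds hc0)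
  obtain ⟨δ, hδ, hball⟩ := mem_nhdsGT_iff_exists_Ioo_subset.1 hev
  filter_upwards [Metric.ball_mem_nhds (0 : ℝ × ℝ) hδ] with x hx
  rcases eq_or_ne x 0 with rfl | hx0
  · simp
  set ρ := ‖x‖
  have hρ : 0 < ρ := norm_pos_iff.2 hx0
  have hb : ∫ z, (φ (ρ * (1 + |z|)) - φ 0 - p * (ρ * (1 + |z|))) / ρ ∂gaussianReal 0 1 +
      ∫ z, (φ (ρ * -(1 + |z|)) - φ 0 - p * (ρ * -(1 + |z|))) / ρ ∂gaussianReal 0 1 < c :=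
    hball ⟨hρ, by simpa using hx⟩
  have hi1 := h.integrable_remainder ρ
  have hi2 : Integrable (fun z => φ (ρ * -(1 + |z|)) - φ 0 - p * (ρ * -(1 + |z|)))
      (gaussianReal 0 1) := by
    have := h.integrable_remainder (-ρ)
    simp only [neg_mul] at this
    simpa only [mul_neg] using this
  rw [integral_div, integral_div, ← add_div, div_lt_iff₀ hρ, ← integral_add hi1 hi2] at hb
  have hG : gaussAvg φ x.1 x.2 - φ 0 - p * x.1 =
      ∫ z, (φ (x.1 + x.2 * z) - φ 0 - p * (x.1 + x.2 * z)) ∂gaussianReal 0 1 := by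
    have hi3 : Integrable (fun z : ℝ => x.1 + x.2 * z) (gaussianReal 0 1) :=
      (integrable_const _).add (integrable_id_stdNormal.const_mul _)
    have hi0 := h.integrable_affine x.1 x.2
    have hi5 : Integrable (fun z : ℝ => φ (x.1 + x.2 * z) - φ 0) (gaussianReal 0 1) :=
      hi0.sub (integrable_const _)
    rw [integral_sub hi5 (hi3.const_mul p), integral_sub hi0 (integrable_const _),
      integral_const_mul, integral_affine_stdNormal]
    simp [gaussAvg]
  have hi4 : Integrable (fun z => φ (x.1 + x.2 * z) - φ 0 - p * (x.1 + x.2 * z))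
      (gaussianReal 0 1) :=
    ((h.integrable_affine _ _).sub (integrable_const _)).sub
      (((integrable_const _).add (integrable_id_stdNormal.const_mul _)).const_mul p)
  have hle : ∫ z, (φ (x.1 + x.2 * z) - φ 0 - p * (x.1 + x.2 * z)) ∂gaussianReal 0 1 ≤ c * ρ := by
    refine (integral_mono hi4 (hi1.add hi2) fun z => ?_).trans hb.le
    have habs : |x.1 + x.2 * z| ≤ ρ * (1 + |z|) := by
      have e1 : |x.1| ≤ ρ := norm_fst_le x
      have e2 : |x.2| ≤ ρ := norm_snd_le x
      calc |x.1 + x.2 * z| ≤ |x.1| + |x.2| * |z| := by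
            rw [← abs_mul]; exact abs_add_le _ _
        _ ≤ ρ + ρ * |z| := by gcongr
        _ = _ := by ring
    have := h.remainder_le habs
    simpa only [mul_neg, Pi.add_apply] using this
  have hge : 0 ≤ ∫ z, (φ (x.1 + x.2 * z) - φ 0 - p * (x.1 + x.2 * z)) ∂gaussianReal 0 1 :=
    integral_nonneg fun z => by have := h.tangent_le (x.1 + x.2 * z); simp only [Pi.zero_apply]; linarith
  have : gaussAvg φ (0 + x).1 (0 + x).2 - gaussAvg φ (0 : ℝ × ℝ).1 (0 : ℝ × ℝ).2 -
      (p • ContinuousLinearMap.fst ℝ ℝ ℝ) x = gaussAvg φ x.1 x.2 - φ 0 - p * x.1 := by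
    simp [gaussAvg_zero_right]
  rw [this, hG, Real.norm_eq_abs, abs_of_nonneg hge]
  exact hle

/-! ### The loss along a ray -/

lemma convexOn_ray (h : IsConvexLoss φ p) (α β : ℝ) :
    ConvexOn ℝ Set.univ (fun c => gaussAvg φ (c * α) (c * β)) := by
  refine ⟨convex_univ, fun x _ y _ a b ha hb hab => ?_⟩
  have := h.convexOn_gaussAvg.2 (Set.mem_univ (x * α, x * β)) (Set.mem_univ (y * α, y * β)) ha hb hab
  simp only [Prod.smul_mk, Prod.mk_add_mk, smul_eq_mul] at this ⊢
  rw [add_mul, add_mul, mul_assoc, mul_assoc, mul_assoc, mul_assoc]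
  exact this

/-- At c = 0 the derivative along the ray is p α ≠ 0, so c = 0 is not a minimizer. -/
lemma exists_ray_lt (h : IsConvexLoss φ p) {α : ℝ} (hα : 0 < α) (β : ℝ) :
    ∃ c, gaussAvg φ (c * α) (c * β) < φ 0 := by
  have h1 : HasFDerivAt (fun x : ℝ × ℝ => gaussAvg φ x.1 x.2) (p • ContinuousLinearMap.fst ℝ ℝ ℝ)
    ((fun c : ℝ => (c * α, c * β)) 0) := by
    have e0 : (fun c : ℝ => (c * α, c * β)) 0 = 0 := by simp
    rw [e0]
    exact h.hasFDerivAt_gaussAvg_zero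
  have h2 : HasDerivAt (fun c : ℝ => (c * α, c * β)) (α, β) 0 := by
    have e1 : HasDerivAt (fun c : ℝ => c * α) α 0 := by simpa using (hasDerivAt_id (0:ℝ)).mul_const α
    have e2 : HasDerivAt (fun c : ℝ => c * β) β 0 := by simpa using (hasDerivAt_id (0:ℝ)).mul_const β
    exact e1.prodMk e2
  have h3 := h1.comp_hasDerivAt (0 : ℝ) h2
  by_contra! hge
  have h4 : IsLocalMin ((fun x : ℝ × ℝ => gaussAvg φ x.1 x.2) ∘ fun c : ℝ => (c * α, c * β)) 0 :=
    Eventually.of_forall fun c => by simpa [gaussAvg_zero_right] using hge c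
  have h5 := h4.hasDerivAt_eq_zero h3
  simp at h5
  rcases h5 with h5 | h5
  · exact h.deriv_neg.ne h5
  · exact hα.ne' h5

lemma le_ray_of_nonpos (h : IsConvexLoss φ p) {α β c : ℝ} (hα : 0 ≤ α) (hc : c ≤ 0) :
    φ 0 ≤ gaussAvg φ (c * α) (c * β) := by
  have hi3 : Integrable (fun z : ℝ => c * α + c * β * z) (gaussianReal 0 1) :=
    (integrable_const _).add (integrable_id_stdNormal.const_mul _)
  have := integral_mono ((integrable_const (φ 0)).add (hi3.const_mul p))
    (h.integrable_affine (c * α) (c * β)) (fun z => h.tangent_le _)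
  simp only [Pi.add_apply] at this
  rw [integral_add (integrable_const _) (hi3.const_mul p), integral_const_mul,
    integral_affine_stdNormal] at this
  simp at this
  have h2 : 0 ≤ p * (c * α) := mul_nonneg_of_nonpos_of_nonpos h.deriv_neg.le
    (mul_nonpos_of_nonpos_of_nonneg hc hα)
  unfold gaussAvg
  linarith

lemma integrable_negPart (α β : ℝ) :
    Integrable (fun z => max 0 (-(α + β * z))) (gaussianReal 0 1) :=
  (((integrable_const α).add (integrable_id_stdNormal.const_mul β)).neg).pos_part.congr
    (ae_of_all _ fun z => by simp [max_comm])

/-- The loss lies above both 0 and the line with slope p, so it grows linearly in c on the event of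
a negative margin. This gives coercivity along the ray and the dimension-free bound on c. -/
lemma mul_negPart_le_ray (h : IsConvexLoss φ p) (α β c : ℝ) :
    -p * c * ∫ z, max 0 (-(α + β * z)) ∂gaussianReal 0 1 ≤ gaussAvg φ (c * α) (c * β) := by
  rw [← integral_const_mul]
  refine integral_mono ((integrable_negPart α β).const_mul _) (h.integrable_affine _ _) fun z => ?_
  have e : c * α + c * β * z = c * (α + β * z) := by ring
  simp only [e]
  have hp := h.deriv_neg
  have h1 := h.tangent_le (c * (α + β * z))
  have h2 := h.nonneg (c * (α + β * z))
  have h3 := h.nonneg 0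
  rcases max_cases 0 (-(α + β * z)) with ⟨hm, _⟩ | ⟨hm, _⟩ <;> rw [hm] <;> nlinarith

lemma negPart_pos {α β : ℝ} (hβ : β ≠ 0) :
    0 < ∫ z, max 0 (-(α + β * z)) ∂gaussianReal 0 1 := by
  by_contra! hle
  have := eq_zero_of_gaussian_integral_nonpos (f := fun z => max 0 (-(α + β * z))) (by fun_prop)
    (fun z => le_max_left _ _) (integrable_negPart α β) hle ((-α - 1) / β)
  rw [mul_div_cancel₀ _ hβ] at this
  norm_num at this

/-- Uniqueness of the minimizer along a ray: the loss is not conical around the origin, being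
differentiable there. -/
lemma ray_min_unique (h : IsConvexLoss φ p) {α β c₁ c₂ : ℝ} (hβ : β ≠ 0) (hc₁ : 0 < c₁)
    (h12 : c₁ < c₂) (hmin : ∀ c, gaussAvg φ (c₁ * α) (c₁ * β) ≤ gaussAvg φ (c * α) (c * β))
    (heq : gaussAvg φ (c₂ * α) (c₂ * β) = gaussAvg φ (c₁ * α) (c₁ * β)) : False := by
  have hcont := h.continuous
  have hc₂ : 0 < c₂ := hc₁.trans h12
  -- The geometric mean c₂ μ of c₁ and c₂ makes the three points μ² t, μ t, t a geometric
  -- progression, so that the equality case below can be iterated.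
  set μ := Real.sqrt (c₁ / c₂) with hμdef
  have hμ2 : μ ^ 2 = c₁ / c₂ := Real.sq_sqrt (by positivity)
  have hμ0 : 0 < μ := Real.sqrt_pos.2 (by positivity)
  have hμ1 : μ < 1 := by
    rw [hμdef, Real.sqrt_lt' one_pos, one_pow, div_lt_one hc₂]; exact h12
  have hc₁' : c₁ = c₂ * μ ^ 2 := by rw [hμ2]; field_simp
  -- Convexity gives ≤ pointwise. Since c₂ μ does no better than the two minimizers, the integrated
  -- inequality is an equality, hence so is the pointwise one.
  have key : ∀ t, (1 + μ) * φ (μ * t) = φ (μ ^ 2 * t) + μ * φ t := by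
    have hconv : ∀ t, (1 + μ) * φ (μ * t) ≤ φ (μ ^ 2 * t) + μ * φ t := by
      intro t
      have := h.convex.2 (Set.mem_univ (μ ^ 2 * t)) (Set.mem_univ t) 
        (show 0 ≤ 1 / (1 + μ) by positivity) (show 0 ≤ μ / (1 + μ) by positivity) (by field_simp)
      simp only [smul_eq_mul] at this
      rw [show 1 / (1 + μ) * (μ ^ 2 * t) + μ / (1 + μ) * t = μ * t by field_simp; ring] at this
      rw [show 1 / (1 + μ) * φ (μ ^ 2 * t) + μ / (1 + μ) * φ t =
        (φ (μ ^ 2 * t) + μ * φ t) / (1 + μ) by ring, le_div_iff₀ (by positivity)] at this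
      linarith
    have i1 := h.integrable_affine (c₁ * α) (c₁ * β)
    have i2 := h.integrable_affine (c₂ * α) (c₂ * β)
    have i3 := h.integrable_affine (c₂ * μ * α) (c₂ * μ * β)
    have hz := eq_zero_of_gaussian_integral_nonpos
      (f := fun z => φ (c₁ * α + c₁ * β * z) + μ * φ (c₂ * α + c₂ * β * z)
        - (1 + μ) * φ (c₂ * μ * α + c₂ * μ * β * z)) (by fun_prop)
      (fun z => by
        have := hconv (c₂ * α + c₂ * β * z)
        rw [show μ * (c₂ * α + c₂ * β * z) = c₂ * μ * α + c₂ * μ * β * z by ring,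
          show μ ^ 2 * (c₂ * α + c₂ * β * z) = c₁ * α + c₁ * β * z by rw [hc₁']; ring] at this
        linarith)
      ((i1.add (i2.const_mul μ)).sub (i3.const_mul _)) (by
        have i4 : Integrable (fun z => φ (c₁ * α + c₁ * β * z) + μ * φ (c₂ * α + c₂ * β * z))
          (gaussianReal 0 1) := i1.add (i2.const_mul μ)
        rw [integral_sub i4 (i3.const_mul _),
          integral_add i1 (i2.const_mul μ), integral_const_mul, integral_const_mul]
        have := hmin (c₂ * μ)
        unfold gaussAvg at this heq
        rw [heq]
        nlinarith)
    intro t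
    have := hz ((t - c₂ * α) / (c₂ * β))
    rw [show c₁ * α + c₁ * β * ((t - c₂ * α) / (c₂ * β)) = μ ^ 2 * t by
        rw [hc₁']; field_simp; ring,
      show c₂ * α + c₂ * β * ((t - c₂ * α) / (c₂ * β)) = t by field_simp; ring,
      show c₂ * μ * α + c₂ * μ * β * ((t - c₂ * α) / (c₂ * β)) = μ * t by field_simp; ring] at this
    linarith
  have hgeom : ∀ (t : ℝ) (n : ℕ), φ (μ ^ n * t) - φ (μ ^ (n + 1) * t) = μ ^ n * (φ t - φ (μ * t)) := by
    intro t n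
    induction n with
    | zero => simp
    | succ n ih =>
      have := key (μ ^ n * t)
      rw [← mul_assoc, ← mul_assoc, ← pow_succ', ← pow_add, add_comm 2 n] at this
      linear_combination this + μ * ih + (φ t - φ (μ * t)) * pow_succ' μ n
  -- By `hgeom` the chord slopes agree at all scales μ ^ n; as n → ∞ they tend to the derivative p
  -- at the origin. Hence φ would be affine.
  have hslope : ∀ t, φ t - φ (μ * t) = p * t * (1 - μ) := by
    intro t
    have hpow : Tendsto (fun n : ℕ => μ ^ n) atTop (𝓝[>] 0) :=
      tendsto_nhdsWithin_iff.2 ⟨tendsto_pow_atTop_nhds_zero_of_lt_one hμ0.le hμ1,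
        Eventually.of_forall fun n => pow_pos hμ0 n⟩
    have l1 := (h.remainder_tendsto t).comp hpow
    have l2 := (h.remainder_tendsto (μ * t)).comp hpow
    have l3 := l1.sub l2
    have hconst : ∀ n : ℕ, φ t - φ (μ * t) - p * t * (1 - μ) =
        (φ (μ ^ n * t) - φ 0 - p * (μ ^ n * t)) / μ ^ n -
          (φ (μ ^ n * (μ * t)) - φ 0 - p * (μ ^ n * (μ * t))) / μ ^ n := by
      intro n
      have := hgeom t n
      have hne : μ ^ n ≠ 0 := (pow_pos hμ0 n).ne'
      rw [← sub_div, eq_div_iff hne, ← mul_assoc (μ ^ n) μ t, ← pow_succ]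
      linear_combination (-this) - p * t * (pow_succ μ n)
    have l4 : Tendsto (fun _ : ℕ => φ t - φ (μ * t) - p * t * (1 - μ)) atTop (𝓝 (0 - 0)) :=
      l3.congr fun n => (hconst n).symm
    have := tendsto_nhds_unique tendsto_const_nhds l4
    linarith
  refine h.not_affine (φ 0) p fun t => ?_
  have hn : ∀ n : ℕ, φ t - p * t = φ (μ ^ n * t) - p * (μ ^ n * t) := by
    intro n
    induction n with
    | zero => simp
    | succ n ih =>
      rw [ih]
      have := hslope (μ ^ n * t)
      rw [← mul_assoc, ← pow_succ'] at this
      rw [pow_succ'] at this ⊢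
      linear_combination this
  have hl : Tendsto (fun n : ℕ => φ (μ ^ n * t) - p * (μ ^ n * t)) atTop (𝓝 (φ (0 * t) - p * (0 * t))) :=
    (Continuous.tendsto (f := fun x => φ (x * t) - p * (x * t)) (by fun_prop) 0).comp
      (tendsto_pow_atTop_nhds_zero_of_lt_one hμ0.le hμ1)
  have := tendsto_nhds_unique (tendsto_const_nhds.congr hn) hl
  simp at this
  linarith

lemma le_of_ray_le (h : IsConvexLoss φ p) {α β c : ℝ} (hβ : β ≠ 0)
    (hc : gaussAvg φ (c * α) (c * β) ≤ φ 0) :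
    c ≤ φ 0 / (-p * ∫ z, max 0 (-(α + β * z)) ∂gaussianReal 0 1) := by
  have hκ := negPart_pos (α := α) hβ
  have hp := h.deriv_neg
  rw [le_div_iff₀ (mul_pos (by linarith) hκ)]
  have := h.mul_negPart_le_ray α β c
  linarith

/-- Existence and uniqueness of the minimizer of the loss along a ray. -/
lemma exists_ray_min (h : IsConvexLoss φ p) {α β : ℝ} (hα : 0 < α) (hβ : β ≠ 0) :
    ∃ c > 0, c ≤ φ 0 / (-p * ∫ z, max 0 (-(α + β * z)) ∂gaussianReal 0 1) ∧
      ∀ c' ≠ c, gaussAvg φ (c * α) (c * β) < gaussAvg φ (c' * α) (c' * β) := by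
  have hcont : Continuous (fun c => gaussAvg φ (c * α) (c * β)) :=
    (h.convexOn_ray α β).locallyLipschitz.continuous
  -- Outside [0, K] the loss is at least φ 0, its value at c = 0, so a minimizer over this compact
  -- interval is global.
  set K := φ 0 / (-p * ∫ z, max 0 (-(α + β * z)) ∂gaussianReal 0 1)
  have h00 : gaussAvg φ (0 * α) (0 * β) = φ 0 := by simp [gaussAvg_zero_right]
  have hK : 0 ≤ K := h.le_of_ray_le hβ h00.le
  obtain ⟨c, hcm, hmin⟩ := isCompact_Icc.exists_isMinOn (Set.nonempty_Icc.2 hK) hcont.continuousOn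
  have hle0 : gaussAvg φ (c * α) (c * β) ≤ φ 0 := by
    have := hmin (Set.left_mem_Icc.2 hK)
    simpa [gaussAvg_zero_right] using this
  have hglob : ∀ c', gaussAvg φ (c * α) (c * β) ≤ gaussAvg φ (c' * α) (c' * β) := by
    intro c'
    rcases le_total c' 0 with h0 | h0
    · exact hle0.trans (h.le_ray_of_nonpos hα.le h0)
    · by_contra! hlt
      exact absurd (hmin ⟨h0, h.le_of_ray_le hβ (hlt.le.trans hle0)⟩) (not_le.2 hlt)
  obtain ⟨c₀, hc₀⟩ := h.exists_ray_lt hα β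
  have hpos : ∀ c', gaussAvg φ (c' * α) (c' * β) ≤ gaussAvg φ (c * α) (c * β) → 0 < c' := by
    intro c' hc'
    by_contra! hle
    have := h.le_ray_of_nonpos (β := β) hα.le hle
    linarith [hglob c₀]
  refine ⟨c, hpos c le_rfl, hcm.2, fun c' hne => lt_of_not_ge fun hle => ?_⟩
  have heq := le_antisymm hle (hglob c')
  rcases lt_or_gt_of_ne hne with hlt | hlt
  · exact h.ray_min_unique hβ (hpos c' hle) hlt (fun x => hle.trans (hglob x)) heq.symm
  · exact h.ray_min_unique hβ (hpos c le_rfl) hlt hglob heq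

end IsConvexLoss

/-! ### Smoothness of Gaussian averages -/

/-- The `j`-th moment of `φ` weighted by the exponential of a quadratic polynomial. -/
def expMoment (φ : ℝ → ℝ) (j : ℕ) (θ : ℝ × ℝ) : ℝ :=
  ∫ x, φ x * x ^ j * Real.exp (θ.1 * x - θ.2 * x ^ 2)

/-- Half of the Gaussian decay absorbs the polynomial and the linear exponential: |x|^j ≤ j! exp
|x|, then complete the square. -/
lemma abs_pow_mul_exp_le (j : ℕ) (a : ℝ) {b : ℝ} (hb : 0 < b) (x : ℝ) :
    |x| ^ j * Real.exp (a * |x| - b * x ^ 2) ≤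
      (j.factorial * Real.exp ((a + 1) ^ 2 / (2 * b))) * Real.exp (-(b / 2) * x ^ 2) := by
  have h1 : |x| ^ j ≤ j.factorial * Real.exp |x| := by
    have := Real.pow_div_factorial_le_exp |x| (abs_nonneg x) j
    rwa [div_le_iff₀ (by positivity), mul_comm] at this
  calc |x| ^ j * Real.exp (a * |x| - b * x ^ 2)
      ≤ (j.factorial * Real.exp |x|) * Real.exp (a * |x| - b * x ^ 2) := by gcongr
    _ = j.factorial * Real.exp ((a + 1) * |x| - b * x ^ 2) := by
        rw [mul_assoc, ← Real.exp_add]; congr 2; ring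
    _ ≤ j.factorial * Real.exp ((a + 1) ^ 2 / (2 * b) + -(b / 2) * x ^ 2) := by
        gcongr
        have h2 : (a + 1) * |x| ≤ (a + 1) ^ 2 / (2 * b) + b / 2 * |x| ^ 2 := by
          have h3 : (a + 1) ^ 2 / (2 * b) + b / 2 * |x| ^ 2 - (a + 1) * |x| =
            ((a + 1) - b * |x|) ^ 2 / (2 * b) := by field_simp; ring
          have h4 : 0 ≤ ((a + 1) - b * |x|) ^ 2 / (2 * b) := by positivity
          linarith
        rw [sq_abs] at h2
        linarith
    _ = _ := by rw [Real.exp_add]; ring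

namespace IsConvexLoss

variable {φ : ℝ → ℝ} {p : ℝ}

lemma integrable_mul_exp_neg_sq (h : IsConvexLoss φ p) {c : ℝ} (hc : 0 < c) :
    Integrable fun x => φ x * Real.exp (-c * x ^ 2) := by
  -- The centered Gaussian density of variance 1 / (2 c) is proportional to exp (-c x²).
  have hv : (Real.toNNReal (1 / (2 * c))) ≠ 0 := by
    simpa [Real.toNNReal_eq_zero] using hc
  have h1 := h.integrable 0 (Real.toNNReal (1 / (2 * c)))
  rw [gaussianReal_of_var_ne_zero _ hv, integrable_withDensity_iff_integrable_smul'
    (measurable_gaussianPDF _ _) (ae_of_all _ fun x => gaussianPDF_lt_top)] at h1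
  simp only [toReal_gaussianPDF, gaussianPDFReal, smul_eq_mul] at h1
  have hcoe : ((Real.toNNReal (1 / (2 * c)) : NNReal) : ℝ) = 1 / (2 * c) :=
    Real.coe_toNNReal _ (by positivity)
  rw [hcoe] at h1
  have hK : Real.sqrt (2 * Real.pi * (1 / (2 * c))) ≠ 0 := by
    have := Real.pi_pos
    positivity
  refine (h1.const_mul (Real.sqrt (2 * Real.pi * (1 / (2 * c))))).congr (ae_of_all _ fun x => ?_)
  simp only
  rw [show -(x - 0) ^ 2 / (2 * (1 / (2 * c))) = -c * x ^ 2 by field_simp; ring]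
  field_simp

lemma integrable_expMoment_bound (h : IsConvexLoss φ p) (j : ℕ) (a : ℝ) {b : ℝ} (hb : 0 < b) :
    Integrable fun x => φ x * (|x| ^ j * Real.exp (a * |x| - b * x ^ 2)) := by
  have hc := h.continuous
  refine ((h.integrable_mul_exp_neg_sq (half_pos hb)).const_mul
    (j.factorial * Real.exp ((a + 1) ^ 2 / (2 * b)))).mono'
    (Continuous.aestronglyMeasurable (by fun_prop)) (ae_of_all _ fun x => ?_)
  rw [Real.norm_eq_abs, abs_of_nonneg (mul_nonneg (h.nonneg x) (by positivity))]
  calc _ ≤ φ x * ((j.factorial * Real.exp ((a + 1) ^ 2 / (2 * b))) *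
        Real.exp (-(b / 2) * x ^ 2)) :=
      mul_le_mul_of_nonneg_left (abs_pow_mul_exp_le j a hb x) (h.nonneg x)
    _ = _ := by ring

lemma norm_expMoment_integrand_le (h : IsConvexLoss φ p) (j : ℕ) {θ : ℝ × ℝ} {a b : ℝ}
    (ha : |θ.1| ≤ a) (hb : b ≤ θ.2) (x : ℝ) :
    ‖φ x * x ^ j * Real.exp (θ.1 * x - θ.2 * x ^ 2)‖ ≤
      φ x * (|x| ^ j * Real.exp (a * |x| - b * x ^ 2)) := by
  rw [norm_mul, norm_mul, Real.norm_eq_abs, Real.norm_eq_abs, Real.norm_eq_abs,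
    abs_of_nonneg (h.nonneg x), abs_pow, abs_of_pos (Real.exp_pos _), mul_assoc]
  refine mul_le_mul_of_nonneg_left ?_ (h.nonneg x)
  have h1 : θ.1 * x ≤ a * |x| :=
    calc θ.1 * x ≤ |θ.1 * x| := le_abs_self _
      _ = |θ.1| * |x| := abs_mul _ _
      _ ≤ a * |x| := by gcongr
  gcongr

lemma integrable_expMoment (h : IsConvexLoss φ p) (j : ℕ) {θ : ℝ × ℝ} (hθ : 0 < θ.2) :
    Integrable fun x => φ x * x ^ j * Real.exp (θ.1 * x - θ.2 * x ^ 2) := by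
  have hc := h.continuous
  exact (h.integrable_expMoment_bound j |θ.1| hθ).mono'
    (Continuous.aestronglyMeasurable (by fun_prop))
    (ae_of_all _ fun x => h.norm_expMoment_integrand_le j le_rfl le_rfl x)

/-- Differentiating the exponential only raises the order of the moment, so the family of moments is
closed under derivatives and smoothness follows by induction. -/
lemma hasFDerivAt_expMoment (h : IsConvexLoss φ p) (j : ℕ) {θ : ℝ × ℝ} (hθ : 0 < θ.2) :
    HasFDerivAt (expMoment φ j) (expMoment φ (j + 1) θ • ContinuousLinearMap.fst ℝ ℝ ℝ -
      expMoment φ (j + 2) θ • ContinuousLinearMap.snd ℝ ℝ ℝ) θ := by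
  have hc := h.continuous
  set F' : ℝ × ℝ → ℝ → (ℝ × ℝ →L[ℝ] ℝ) := fun θ x =>
    (φ x * x ^ (j + 1) * Real.exp (θ.1 * x - θ.2 * x ^ 2)) • ContinuousLinearMap.fst ℝ ℝ ℝ -
    (φ x * x ^ (j + 2) * Real.exp (θ.1 * x - θ.2 * x ^ 2)) • ContinuousLinearMap.snd ℝ ℝ ℝ with hF'
  have hI : ∫ x, F' θ x = expMoment φ (j + 1) θ • ContinuousLinearMap.fst ℝ ℝ ℝ -
      expMoment φ (j + 2) θ • ContinuousLinearMap.snd ℝ ℝ ℝ := by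
    rw [hF', integral_sub ((h.integrable_expMoment (j + 1) hθ).smul_const _)
      ((h.integrable_expMoment (j + 2) hθ).smul_const _), integral_smul_const,
      integral_smul_const]
    rfl
  rw [← hI]
  set a := |θ.1| + θ.2 / 2 with ha
  have hb := half_pos hθ
  refine hasFDerivAt_integral_of_dominated_of_fderiv_le
    (F := fun θ x => φ x * x ^ j * Real.exp (θ.1 * x - θ.2 * x ^ 2))
    (bound := fun x => φ x * (|x| ^ (j + 1) * Real.exp (a * |x| - θ.2 / 2 * x ^ 2)) +
      φ x * (|x| ^ (j + 2) * Real.exp (a * |x| - θ.2 / 2 * x ^ 2)))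
    (Metric.ball_mem_nhds θ hb) (Eventually.of_forall fun θ =>
      Continuous.aestronglyMeasurable (by fun_prop))
    (h.integrable_expMoment j hθ)
    (((h.integrable_expMoment (j + 1) hθ).smul_const _).sub
      ((h.integrable_expMoment (j + 2) hθ).smul_const _)).aestronglyMeasurable
    (ae_of_all _ fun x θ' hθ' => ?_)
    ((h.integrable_expMoment_bound _ _ hb).add (h.integrable_expMoment_bound _ _ hb))
    (ae_of_all _ fun x θ' _ => ?_)
  · have hd : ‖θ' - θ‖ < θ.2 / 2 := by simpa [dist_eq_norm] using hθ'
    have h1 : |θ'.1| ≤ a := by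
      have := (norm_fst_le (θ' - θ)).trans hd.le
      have h2 : |θ'.1| ≤ |θ.1| + |θ'.1 - θ.1| := by
        calc |θ'.1| = |θ.1 + (θ'.1 - θ.1)| := by ring_nf
          _ ≤ _ := abs_add_le _ _
      rw [Prod.fst_sub, Real.norm_eq_abs] at this
      rw [ha]; linarith
    have h2 : θ.2 / 2 ≤ θ'.2 := by
      have := (norm_snd_le (θ' - θ)).trans hd.le
      rw [Prod.snd_sub, Real.norm_eq_abs] at this
      linarith [(abs_le.1 this).1]
    refine (norm_sub_le _ _).trans (add_le_add ?_ ?_)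
    · rw [norm_smul]
      exact (mul_le_of_le_one_right (norm_nonneg _) (ContinuousLinearMap.norm_fst_le ℝ ℝ ℝ)).trans
        (h.norm_expMoment_integrand_le _ h1 h2 x)
    · rw [norm_smul]
      exact (mul_le_of_le_one_right (norm_nonneg _) (ContinuousLinearMap.norm_snd_le ℝ ℝ ℝ)).trans
        (h.norm_expMoment_integrand_le _ h1 h2 x)
  · have h1 : HasFDerivAt (fun θ : ℝ × ℝ => θ.1 * x - θ.2 * x ^ 2)
        (x • ContinuousLinearMap.fst ℝ ℝ ℝ - x ^ 2 • ContinuousLinearMap.snd ℝ ℝ ℝ) θ' :=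
      (hasFDerivAt_fst.mul_const x).sub (hasFDerivAt_snd.mul_const (x ^ 2))
    refine (h1.exp.const_mul (φ x * x ^ j)).congr_fderiv ?_
    ext <;> simp [hF'] <;> ring

lemma contDiffOn_expMoment (h : IsConvexLoss φ p) (n : ℕ) (j : ℕ) :
    ContDiffOn ℝ n (expMoment φ j) {θ : ℝ × ℝ | 0 < θ.2} := by
  have ho : IsOpen {θ : ℝ × ℝ | 0 < θ.2} := isOpen_lt continuous_const continuous_snd
  induction n generalizing j with
  | zero =>
    refine contDiffOn_zero.2 fun θ hθ => ?_
    exact (h.hasFDerivAt_expMoment j hθ).continuousAt.continuousWithinAt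
  | succ n ih =>
    push_cast
    rw [contDiffOn_succ_iff_fderiv_of_isOpen ho]
    refine ⟨fun θ hθ => (h.hasFDerivAt_expMoment j hθ).differentiableAt.differentiableWithinAt,
      by simp, ?_⟩
    refine ContDiffOn.congr (f := fun θ => expMoment φ (j + 1) θ • ContinuousLinearMap.fst ℝ ℝ ℝ -
      expMoment φ (j + 2) θ • ContinuousLinearMap.snd ℝ ℝ ℝ) ?_
      fun θ hθ => (h.hasFDerivAt_expMoment j hθ).fderiv
    exact ((ih (j + 1)).smul contDiffOn_const).sub ((ih (j + 2)).smul contDiffOn_const)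

/-- Expanding the square in the density moves m and s from the argument of φ into an exponential,
where smoothness of φ is irrelevant. -/
lemma gaussAvg_eq_expMoment (h : IsConvexLoss φ p) (m : ℝ) {s : ℝ} (hs : 0 < s) :
    gaussAvg φ m s = (Real.sqrt (2 * Real.pi * s ^ 2))⁻¹ * Real.exp (-m ^ 2 / (2 * s ^ 2)) *
      expMoment φ 0 (m / s ^ 2, 1 / (2 * s ^ 2)) := by
  have hv : (.mk (s ^ 2) (sq_nonneg s) : NNReal) ≠ 0 := by
    rw [← NNReal.coe_ne_zero]
    exact (pow_pos hs 2).ne'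
  rw [← integral_gaussianReal_eq_gaussAvg h.continuous, integral_gaussianReal_eq_integral_smul hv,
    expMoment, ← integral_const_mul]
  congr 1
  ext x
  simp only [gaussianPDFReal, smul_eq_mul, pow_zero, mul_one, NNReal.coe_mk]
  rw [show -(x - m) ^ 2 / (2 * s ^ 2) =
    -m ^ 2 / (2 * s ^ 2) + (m / s ^ 2 * x - 1 / (2 * s ^ 2) * x ^ 2) by field_simp; ring,
    Real.exp_add]
  ring

lemma contDiffAt_gaussAvg (h : IsConvexLoss φ p) (n : ℕ) (m : ℝ) {s : ℝ} (hs : 0 < s) :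
    ContDiffAt ℝ n (fun x : ℝ × ℝ => gaussAvg φ x.1 x.2) (m, s) := by
  have hev : (fun x : ℝ × ℝ => gaussAvg φ x.1 x.2) =ᶠ[𝓝 (m, s)] fun x =>
      (Real.sqrt (2 * Real.pi * x.2 ^ 2))⁻¹ * Real.exp (-x.1 ^ 2 / (2 * x.2 ^ 2)) *
      expMoment φ 0 (x.1 / x.2 ^ 2, 1 / (2 * x.2 ^ 2)) := by
    filter_upwards [(isOpen_lt continuous_const continuous_snd).mem_nhds
      (show (0 : ℝ) < (m, s).2 from hs)] with x hx
    exact h.gaussAvg_eq_expMoment x.1 hx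
  refine ContDiffAt.congr_of_eventuallyEq ?_ hev
  have h1 : ContDiffAt ℝ n (fun x : ℝ × ℝ => (Real.sqrt (2 * Real.pi * x.2 ^ 2))⁻¹) (m, s) := by
    have hne : 2 * Real.pi * s ^ 2 ≠ 0 := by have := Real.pi_pos; positivity
    have e1 : ContDiffAt ℝ n (fun x : ℝ × ℝ => 2 * Real.pi * x.2 ^ 2) (m, s) := by fun_prop
    exact (e1.sqrt hne).inv (Real.sqrt_ne_zero'.2 (by
      have := Real.pi_pos; positivity))
  have h2 : ContDiffAt ℝ n (fun x : ℝ × ℝ => Real.exp (-x.1 ^ 2 / (2 * x.2 ^ 2))) (m, s) :=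
    (ContDiffAt.div (by fun_prop) (by fun_prop) (by positivity)).exp
  have h3 : ContDiffAt ℝ n (fun x : ℝ × ℝ => (x.1 / x.2 ^ 2, 1 / (2 * x.2 ^ 2))) (m, s) :=
    (ContDiffAt.div (by fun_prop) (by fun_prop) (by positivity)).prodMk
      (ContDiffAt.div (by fun_prop) (by fun_prop) (by positivity))
  have h4 : ContDiffAt ℝ n (expMoment φ 0)
      ((fun x : ℝ × ℝ => (x.1 / x.2 ^ 2, 1 / (2 * x.2 ^ 2))) (m, s)) :=
    (h.contDiffOn_expMoment n 0).contDiffAt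
      ((isOpen_lt continuous_const continuous_snd).mem_nhds (by simp; positivity))
  have h5 : ContDiffAt ℝ n (fun x : ℝ × ℝ => expMoment φ 0 (x.1 / x.2 ^ 2, 1 / (2 * x.2 ^ 2)))
    (m, s) := ContDiffAt.comp (g := expMoment φ 0) (m, s) h4 h3
  exact (h1.mul h2).mul h5

end IsConvexLoss

/-! ### Gradient descent for convex functions with a degenerate direction -/

section ConvexGradient

variable {E : Type*} [NormedAddCommGroup E] [InnerProductSpace ℝ E] [CompleteSpace E]
  {R : E → ℝ}

lemma inner_gradient_le_sub (hd : Differentiable ℝ R) (hc : ConvexOn ℝ Set.univ R) (w v : E) :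
    inner ℝ (gradient R w) (v - w) ≤ R v - R w := by
  have hg : ConvexOn ℝ Set.univ (fun t : ℝ => R (AffineMap.lineMap w v t)) := by
    have := hc.comp_affineMap (AffineMap.lineMap w v : ℝ →ᵃ[ℝ] E)
    rwa [Set.preimage_univ] at this
  have hder : HasDerivAt (fun t : ℝ => R (AffineMap.lineMap w v t))
      (fderiv ℝ R (AffineMap.lineMap w v (0 : ℝ)) (v - w)) 0 :=
    (hd _).hasFDerivAt.comp_hasDerivAt (0 : ℝ) AffineMap.hasDerivAt_lineMap
  have := hg.le_slope_of_hasDerivAt (Set.mem_univ 0) (Set.mem_univ 1) one_pos hder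
  simpa [slope_def_field, inner_gradient_left] using this

/-- By convexity, a unit step in the direction of the gradient raises R by at least the norm of the
gradient. -/
lemma norm_gradient_le_of_forall_le (hd : Differentiable ℝ R) (hc : ConvexOn ℝ Set.univ R)
    (hn : ∀ w, 0 ≤ R w) {w : E} {A : ℝ} (hA : ∀ v, ‖v - w‖ ≤ 1 → R v ≤ A) :
    ‖gradient R w‖ ≤ A := by
  set g := gradient R w with hg
  rcases eq_or_ne g 0 with h0 | h0
  · rw [h0, norm_zero]
    exact (hn w).trans (hA w (by simp))
  have hpos : 0 < ‖g‖ := norm_pos_iff.2 h0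
  have h1 := inner_gradient_le_sub hd hc w (w + ‖g‖⁻¹ • g)
  rw [← hg, add_sub_cancel_left, inner_smul_right, real_inner_self_eq_norm_sq] at h1
  have h2 := hA (w + ‖g‖⁻¹ • g) (by
    rw [add_sub_cancel_left, norm_smul, norm_inv, norm_norm, inv_mul_cancel₀ hpos.ne'])
  have h3 := hn w
  rw [sq, inv_mul_cancel_left₀ hpos.ne'] at h1
  linarith

lemma gradient_eq_zero_of_forall_le {u : E} (hmin : ∀ w, R u ≤ R w) : gradient R u = 0 := by
  have h : IsLocalMin R u := Eventually.of_forall hmin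
  simp [gradient, h.fderiv_eq_zero]

lemma norm_gradient_sub_gradient (w v : E) :
    ‖gradient R w - gradient R v‖ = ‖fderiv ℝ R w - fderiv ℝ R v‖ := by
  rw [gradient, gradient, ← map_sub, LinearIsometryEquiv.norm_map]

/-- Near a minimizer at which the function is twice continuously differentiable, the squared norm
of the gradient is controlled by the suboptimality. -/
lemma exists_sq_norm_gradient_le_near (hd : Differentiable ℝ R) {u : E} (hmin : ∀ w, R u ≤ R w)
    (hs : ContDiffAt ℝ 2 R u) :
    ∃ r > 0, ∃ L > 0, ∀ v, ‖v - u‖ < r → ‖gradient R v‖ ^ 2 ≤ L * (R v - R u) := by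
  obtain ⟨K, t, ht, hK⟩ := (hs.fderiv_right (m := 1) (by norm_num)).exists_lipschitzOnWith
  obtain ⟨r, hr, hball⟩ := Metric.mem_nhds_iff.1 ht
  have hlip : ∀ v w, ‖v - u‖ < r → ‖w - u‖ < r → ‖fderiv ℝ R v - fderiv ℝ R w‖ ≤ K * ‖v - w‖ := by
    intro v w hv hw
    have := hK.dist_le_mul v (hball (by simpa [dist_eq_norm] using hv)) w
      (hball (by simpa [dist_eq_norm] using hw))
    simpa [dist_eq_norm] using this
  have hK0 : (0 : ℝ) ≤ K := K.2
  set L : ℝ := K + 1 with hL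
  have hLpos : 0 < L := by positivity
  refine ⟨r / 2, half_pos hr, 4 * L, by positivity, fun v hv => ?_⟩
  set g := gradient R v with hg
  have hgn : ‖g‖ ≤ K * ‖v - u‖ := by
    have := hlip v u (by linarith) (by simpa using hr)
    rw [← norm_gradient_sub_gradient, gradient_eq_zero_of_forall_le hmin, sub_zero] at this
    exact this
  -- One gradient step cannot go below R u. The mean value form of the descent lemma has error K ‖w
  -- - v‖² without the factor 1/2, hence the step 1 / (2 L); it also keeps w within r of u.
  set w := v - (2 * L)⁻¹ • g with hw
  have hwv : w - v = -((2 * L)⁻¹ • g) := by rw [hw]; abel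
  have hwvn : ‖w - v‖ = (2 * L)⁻¹ * ‖g‖ := by
    rw [hwv, norm_neg, norm_smul, Real.norm_eq_abs, abs_of_pos (by positivity)]
  have hwvle : ‖w - v‖ ≤ ‖v - u‖ := by
    rw [hwvn, inv_mul_le_iff₀ (by positivity)]
    nlinarith [norm_nonneg (v - u)]
  have hwu : ‖w - u‖ < r := by
    calc ‖w - u‖ ≤ ‖w - v‖ + ‖v - u‖ := norm_sub_le_norm_sub_add_norm_sub _ _ _
      _ < r := by linarith
  have hseg : ∀ x ∈ segment ℝ v w, ‖fderiv ℝ R x - fderiv ℝ R v‖ ≤ K * ‖w - v‖ := by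
    intro x hx
    have hxb : x ∈ Metric.ball u r := (convex_ball u r).segment_subset
      (by simpa [dist_eq_norm] using hv.trans (half_lt_self hr))
      (by simpa [dist_eq_norm] using hwu) hx
    refine (hlip x v (by simpa [dist_eq_norm] using hxb) (by linarith)).trans ?_
    gcongr
    exact norm_sub_le_of_mem_segment hx
  have hdesc := (convex_segment v w).norm_image_sub_le_of_norm_fderiv_le' (𝕜 := ℝ) (f := R)
    (fun x _ => hd x) hseg (left_mem_segment ℝ v w) (right_mem_segment ℝ v w)
  rw [← inner_gradient_left (f := R), ← hg] at hdesc
  have h1 := (abs_le.1 ((Real.norm_eq_abs _).symm.le.trans hdesc)).2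
  rw [hwv, inner_neg_right, inner_smul_right, real_inner_self_eq_norm_sq, ← hwv, hwvn] at h1
  have h2 := hmin w
  have h3 : K * ((2 * L)⁻¹ * ‖g‖) * ((2 * L)⁻¹ * ‖g‖) ≤ (4 * L)⁻¹ * ‖g‖ ^ 2 := by
    have e : K * ((2 * L)⁻¹ * ‖g‖) * ((2 * L)⁻¹ * ‖g‖) = (K / L) * ((4 * L)⁻¹ * ‖g‖ ^ 2) := by
      field_simp; ring
    rw [e]
    exact mul_le_of_le_one_left (by positivity) ((div_le_one hLpos).2 (by linarith))
  have h4 : (2 * L)⁻¹ * ‖g‖ ^ 2 = 2 * ((4 * L)⁻¹ * ‖g‖ ^ 2) := by field_simp; ring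
  have h5 : (4 * L)⁻¹ * ‖g‖ ^ 2 ≤ R v - R u := by linarith
  rwa [inv_mul_le_iff₀ (by positivity)] at h5

end ConvexGradient

/-- A convex differentiable function factoring through an orthogonal projection `P`, with a unique
minimizer `u` on the range of `P`, at which it is twice continuously differentiable. -/
structure IsProjConvex {E : Type*} [NormedAddCommGroup E] [InnerProductSpace ℝ E]
    (R : E → ℝ) (P : E →L[ℝ] E) (u : E) : Prop where
  differentiable : Differentiable ℝ R
  convex : ConvexOn ℝ Set.univ R
  nonneg : ∀ w, 0 ≤ R w
  idem : ∀ w, P (P w) = P w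
  symm : ∀ x y, inner ℝ (P x) y = inner ℝ x (P y)
  apply_proj : ∀ w, R (P w) = R w
  proj_min : P u = u
  lt_of_ne : ∀ v, P v = v → v ≠ u → R u < R v
  contDiffAt : ContDiffAt ℝ 2 R u

namespace IsProjConvex

variable {E : Type*} [NormedAddCommGroup E] [InnerProductSpace ℝ E]
  {R : E → ℝ} {P : E →L[ℝ] E} {u : E}

lemma min_le (h : IsProjConvex R P u) (w : E) : R u ≤ R w := by
  rw [← h.apply_proj w]
  by_cases hw : P w = u
  · rw [hw]
  · exact (h.lt_of_ne _ (h.idem w) hw).le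

variable [FiniteDimensional ℝ E]

/-- Chain rule for R = R ∘ P, with P self-adjoint. Consequently the component of the iterates in ker
P is constant and the component in the range performs gradient descent by itself. -/
lemma gradient_eq (h : IsProjConvex R P u) (w : E) :
    gradient R w = P (gradient R (P w)) := by
  refine ext_inner_right ℝ fun y => ?_
  rw [h.symm, inner_gradient_left, inner_gradient_left]
  have h1 : HasFDerivAt (R ∘ P) ((fderiv ℝ R (P w)).comp P) w :=
    (h.differentiable _).hasFDerivAt.comp w P.hasFDerivAt
  have h2 : R ∘ P = R := funext h.apply_proj
  rw [h2] at h1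
  rw [h1.fderiv]
  rfl

lemma proj_gradient (h : IsProjConvex R P u) (w : E) : P (gradient R w) = gradient R w := by
  rw [h.gradient_eq w, h.idem]

lemma gradient_proj (h : IsProjConvex R P u) (w : E) : gradient R (P w) = gradient R w := by
  rw [h.gradient_eq w, h.proj_gradient]

/-- Compactness turns uniqueness of the minimizer into a uniform gap. -/
lemma exists_gap (h : IsProjConvex R P u) {r : ℝ} (hr : 0 < r) (ρ : ℝ) :
    ∃ δ > 0, ∀ v, P v = v → r ≤ ‖v - u‖ → ‖v - u‖ ≤ ρ → δ ≤ R v - R u := by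
  have hcl : IsClosed {v : E | P v = v ∧ r ≤ ‖v - u‖} :=
    (isClosed_eq P.continuous continuous_id).inter
      (isClosed_le continuous_const (continuous_id.sub continuous_const).norm)
  have hK : IsCompact ({v : E | P v = v ∧ r ≤ ‖v - u‖} ∩ Metric.closedBall u ρ) :=
    (isCompact_closedBall u ρ).inter_left hcl
  rcases ({v : E | P v = v ∧ r ≤ ‖v - u‖} ∩ Metric.closedBall u ρ).eq_empty_or_nonempty with he | hne
  · refine ⟨1, one_pos, fun v h1 h2 h3 => ?_⟩
    have : v ∈ ({v : E | P v = v ∧ r ≤ ‖v - u‖} ∩ Metric.closedBall u ρ) :=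
      ⟨⟨h1, h2⟩, by simpa [dist_eq_norm] using h3⟩
    simp [he] at this
  · obtain ⟨v₀, hv₀, hmin⟩ := hK.exists_isMinOn hne h.differentiable.continuous.continuousOn
    refine ⟨R v₀ - R u, sub_pos.2 (h.lt_of_ne v₀ hv₀.1.1 ?_), fun v h1 h2 h3 => ?_⟩
    · rintro rfl
      have := hv₀.1.2
      simp at this
      linarith
    · have : R v₀ ≤ R v := hmin ⟨⟨h1, h2⟩, by simpa [dist_eq_norm] using h3⟩
      linarith

/-- This replaces a global Lipschitz bound on the gradient. Near u the function is C²; away from u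
the gradient is bounded on the ball and the suboptimality is bounded below by the gap. -/
lemma exists_sq_norm_gradient_le (h : IsProjConvex R P u) (ρ : ℝ) :
    ∃ L > 0, ∀ v, P v = v → ‖v - u‖ ≤ ρ → ‖gradient R v‖ ^ 2 ≤ L * (R v - R u) := by
  obtain ⟨r, hr, L, hL, hnear⟩ :=
    exists_sq_norm_gradient_le_near h.differentiable h.min_le h.contDiffAt
  obtain ⟨δ, hδ, hgap⟩ := h.exists_gap hr ρ
  obtain ⟨A, hA⟩ := (isCompact_closedBall u (ρ + 1)).bddAbove_image
    h.differentiable.continuous.continuousOn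
  refine ⟨max L (A ^ 2 / δ), lt_max_of_lt_left hL, fun v hv hρ => ?_⟩
  have hsub : 0 ≤ R v - R u := sub_nonneg.2 (h.min_le v)
  rcases lt_or_ge ‖v - u‖ r with hlt | hge
  · exact (hnear v hlt).trans (mul_le_mul_of_nonneg_right (le_max_left _ _) hsub)
  · have h1 : ‖gradient R v‖ ≤ A := by
      refine norm_gradient_le_of_forall_le h.differentiable h.convex h.nonneg fun x hx => ?_
      refine hA ⟨x, ?_, rfl⟩
      rw [Metric.mem_closedBall, dist_eq_norm]
      calc ‖x - u‖ ≤ ‖x - v‖ + ‖v - u‖ := norm_sub_le_norm_sub_add_norm_sub _ _ _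
        _ ≤ ρ + 1 := by linarith
    calc ‖gradient R v‖ ^ 2 ≤ A ^ 2 := by gcongr
      _ = A ^ 2 / δ * δ := by field_simp
      _ ≤ A ^ 2 / δ * (R v - R u) := by
        gcongr
        exact hgap v hv hge hρ
      _ ≤ _ := mul_le_mul_of_nonneg_right (le_max_right _ _) hsub

/-- Each step decreases ‖v t - u‖² by at least η (R (v t) - R u): convexity contributes 2η times the
suboptimality, and the gradient term costs at most η times it. The iterates thus stay in the ball,
the decreases tend to 0, and the gap forces convergence. -/
lemma tendsto_of_recurrence (h : IsProjConvex R P u) {ρ L η : ℝ}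
    (hL : ∀ v, P v = v → ‖v - u‖ ≤ ρ → ‖gradient R v‖ ^ 2 ≤ L * (R v - R u))
    (hη : 0 < η) (hηL : η * L ≤ 1) {v : ℕ → E} (h0 : P (v 0) = v 0) (hρ : ‖v 0 - u‖ ≤ ρ)
    (hrec : ∀ t, v (t + 1) = v t - η • gradient R (v t)) :
    Tendsto v atTop (𝓝 u) := by
  have hPv : ∀ t, P (v t) = v t := by
    intro t
    induction t with
    | zero => exact h0
    | succ t ih => rw [hrec, map_sub, map_smul, ih, h.proj_gradient]
  have hstep : ∀ t, ‖v t - u‖ ≤ ρ →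
      ‖v (t + 1) - u‖ ^ 2 ≤ ‖v t - u‖ ^ 2 - η * (R (v t) - R u) := by
    intro t ht
    have h1 := hL _ (hPv t) ht
    have h2 := inner_gradient_le_sub h.differentiable h.convex (v t) u
    have hsub : 0 ≤ R (v t) - R u := sub_nonneg.2 (h.min_le _)
    have e : v (t + 1) - u = (v t - u) - η • gradient R (v t) := by rw [hrec]; abel
    rw [e, norm_sub_sq_real, inner_smul_right, norm_smul, mul_pow, Real.norm_eq_abs, sq_abs]
    have h3 : inner ℝ (v t - u) (gradient R (v t)) = - inner ℝ (gradient R (v t)) (u - v t) := by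
      rw [real_inner_comm, ← inner_neg_right, neg_sub]
    rw [h3]
    have h4 : η ^ 2 * ‖gradient R (v t)‖ ^ 2 ≤ η * (R (v t) - R u) := by
      calc η ^ 2 * ‖gradient R (v t)‖ ^ 2 ≤ η ^ 2 * (L * (R (v t) - R u)) := by gcongr
        _ = (η * L) * (η * (R (v t) - R u)) := by ring
        _ ≤ _ := mul_le_of_le_one_left (by positivity) hηL
    nlinarith
  have hmono : ∀ t, ‖v t - u‖ ≤ ρ ∧ ‖v (t + 1) - u‖ ≤ ‖v t - u‖ := by
    have aux : ∀ t, ‖v t - u‖ ≤ ρ → ‖v (t + 1) - u‖ ≤ ‖v t - u‖ := by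
      intro t ht
      refine abs_le_of_sq_le_sq' ?_ (norm_nonneg _) |>.2
      have := hstep t ht
      have hsub : 0 ≤ η * (R (v t) - R u) := mul_nonneg hη.le (sub_nonneg.2 (h.min_le _))
      linarith
    intro t
    induction t with
    | zero => exact ⟨hρ, aux 0 hρ⟩
    | succ t ih => exact ⟨ih.2.trans ih.1, aux _ (ih.2.trans ih.1)⟩
  have hanti : Antitone fun t => ‖v t - u‖ ^ 2 := antitone_nat_of_succ_le fun t => by
    have := (hmono t).2
    gcongr
  have hlim := tendsto_atTop_ciInf hanti ⟨0, by rintro _ ⟨t, rfl⟩; positivity⟩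
  have hdiff : Tendsto (fun t => ‖v t - u‖ ^ 2 - ‖v (t + 1) - u‖ ^ 2) atTop (𝓝 0) := by
    have := hlim.sub (hlim.comp (tendsto_add_atTop_nat 1))
    simpa using this
  rw [Metric.tendsto_atTop']
  intro ε hε
  obtain ⟨δ, hδ, hgap⟩ := h.exists_gap hε ρ
  obtain ⟨T, hT⟩ := (hdiff.eventually (Iio_mem_nhds (mul_pos hη hδ))).exists_forall_of_atTop
  refine ⟨T, fun t ht => ?_⟩
  rw [dist_eq_norm]
  by_contra! hge
  have h1 := hgap _ (hPv t) hge (hmono t).1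
  have h2 := hstep t (hmono t).1
  have h3 : ‖v t - u‖ ^ 2 - ‖v (t + 1) - u‖ ^ 2 < η * δ := hT t ht.le
  nlinarith

end IsProjConvex

lemma IsProjConvex.tendsto_gradDescent {d : ℕ} {R : Vec d → ℝ} {P : Vec d →L[ℝ] Vec d} {u : Vec d}
    (h : IsProjConvex R P u) (B : ℝ) :
    ∃ η₀ : ℝ, 0 < η₀ ∧ ∀ η : ℝ, 0 < η → η < η₀ → ∀ w₀ : Vec d, ‖w₀‖ ≤ B →
      Tendsto (gradDescent R η w₀) atTop (𝓝 (u + (w₀ - P w₀))) := by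
  -- This radius bounds ‖P w₀ - u‖ for all ‖w₀‖ ≤ B, so one step size serves all these initial
  -- points.
  obtain ⟨L, hL0, hL⟩ := h.exists_sq_norm_gradient_le (‖P‖ * B + ‖u‖)
  refine ⟨1 / L, by positivity, fun η hη hηL w₀ hw₀ => ?_⟩
  have hrec : ∀ t, gradDescent R η w₀ (t + 1) =
      gradDescent R η w₀ t - η • gradient R (gradDescent R η w₀ t) := fun t => rfl
  have hconst : ∀ t, gradDescent R η w₀ t = P (gradDescent R η w₀ t) + (w₀ - P w₀) := by
    intro t
    induction t with
    | zero => simp [gradDescent]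
    | succ t ih =>
      rw [hrec, map_sub, map_smul, h.proj_gradient]
      nth_rewrite 1 [ih]
      abel
  have hlim : Tendsto (fun t => P (gradDescent R η w₀ t)) atTop (𝓝 u) := by
    refine h.tendsto_of_recurrence hL hη ?_ (h.idem _) ?_ fun t => ?_
    · rw [lt_div_iff₀ hL0] at hηL
      exact hηL.le
    · refine (norm_sub_le _ _).trans ?_
      have : ‖P (gradDescent R η w₀ 0)‖ ≤ ‖P‖ * B :=
        (P.le_opNorm _).trans (mul_le_mul_of_nonneg_left hw₀ (norm_nonneg _))
      linarith
    · rw [hrec, map_sub, map_smul, h.proj_gradient, h.gradient_proj]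
  exact (hlim.add_const (w₀ - P w₀)).congr fun t => (hconst t).symm

/-! ### The law of the data -/

variable {d : ℕ}

/-- The orthogonal projection onto the coordinates at which `wstar` does not vanish. -/
def suppProj (wstar : Vec d) : Vec d →L[ℝ] Vec d :=
  Matrix.toEuclideanCLM (𝕜 := ℝ) (Matrix.diagonal fun i => if wstar i ≠ 0 then 1 else 0)

@[simp]
lemma suppProj_apply (wstar w : Vec d) (i : Fin d) :
    suppProj wstar w i = if wstar i ≠ 0 then w i else 0 := by
  by_cases h : wstar i = 0 <;>
    simp [suppProj, Matrix.ofLp_toEuclideanCLM, Matrix.mulVec_diagonal, h]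

lemma suppProj_idem (wstar w : Vec d) : suppProj wstar (suppProj wstar w) = suppProj wstar w := by
  ext i
  simp only [suppProj_apply]
  split_ifs <;> rfl

lemma suppProj_self (wstar : Vec d) : suppProj wstar wstar = wstar := by
  ext i
  rw [suppProj_apply]
  split_ifs with h
  · rfl
  · exact (not_not.1 h).symm

lemma inner_suppProj (wstar x y : Vec d) :
    inner ℝ (suppProj wstar x) y = inner ℝ x (suppProj wstar y) := by
  simp [PiLp.inner_apply]

lemma inner_suppProj_self (wstar w : Vec d) :
    inner ℝ (suppProj wstar w) wstar = inner ℝ w wstar := by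
  rw [inner_suppProj, suppProj_self]

lemma dataCov_posSemidef (wstar : Vec d) (σ : ℝ) : (dataCov wstar σ).PosSemidef :=
  Matrix.PosSemidef.diagonal fun i => by
    simp only [Pi.zero_apply]; split_ifs <;> positivity

lemma dotProduct_dataCov (wstar t : Vec d) (σ : ℝ) :
    t.ofLp ⬝ᵥ (dataCov wstar σ).mulVec t.ofLp = σ ^ 2 * ‖suppProj wstar t‖ ^ 2 := by
  rw [EuclideanSpace.real_norm_sq_eq, Finset.mul_sum, dotProduct]
  refine Finset.sum_congr rfl fun i _ => ?_
  rw [dataCov, Matrix.mulVec_diagonal, suppProj_apply]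
  split_ifs <;> ring

lemma charFun_data (μ wstar t : Vec d) (σ : ℝ) :
    charFun (multivariateGaussian μ (dataCov wstar σ)) t =
      Complex.exp (inner ℝ t μ * Complex.I - ((σ * ‖suppProj wstar t‖) ^ 2 : ℝ) / 2) := by
  rw [charFun_multivariateGaussian (dataCov_posSemidef wstar σ), dotProduct_dataCov, mul_pow]

lemma measurable_lin (w : Vec d) : Measurable (lin w) := by unfold lin; fun_prop

lemma map_lin_data (μ wstar w : Vec d) (σ : ℝ) :
    (multivariateGaussian μ (dataCov wstar σ)).map (lin w) =
      gaussianReal (inner ℝ w μ) (.mk ((σ * ‖suppProj wstar w‖) ^ 2) (sq_nonneg _)) := by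
  have : IsFiniteMeasure ((multivariateGaussian μ (dataCov wstar σ)).map (lin w)) :=
    Measure.isFiniteMeasure_map _ _
  refine Measure.ext_of_charFun (funext fun t => ?_)
  rw [charFun_gaussianReal, charFun_apply_real, integral_map (measurable_lin w).aemeasurable
    (Continuous.aestronglyMeasurable (by fun_prop))]
  have h := charFun_data μ wstar (t • w) σ
  rw [charFun_apply] at h
  have e : ∀ x : Vec d, Complex.exp (t * (lin w x : ℝ) * Complex.I) =
      Complex.exp ((inner ℝ x (t • w) : ℝ) * Complex.I) := by
    intro x
    rw [lin, inner_smul_right, real_inner_comm]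
    push_cast; rfl
  simp_rw [e]
  rw [h, inner_smul_left, map_smul, norm_smul]
  congr 1
  simp only [conj_trivial, NNReal.coe_mk, Real.norm_eq_abs]
  rw [show (σ * (|t| * ‖suppProj wstar w‖)) ^ 2 = (σ * ‖suppProj wstar w‖) ^ 2 * t ^ 2 by
    rw [mul_pow, mul_pow, sq_abs]; ring]
  push_cast
  ring

lemma integral_lin_data {f : ℝ → ℝ} (hf : Continuous f) (μ wstar w : Vec d) (σ : ℝ) :
    ∫ x, f (lin w x) ∂(multivariateGaussian μ (dataCov wstar σ)) =
      gaussAvg f (inner ℝ w μ) (σ * ‖suppProj wstar w‖) := by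
  rw [← integral_gaussianReal_eq_gaussAvg hf, ← map_lin_data,
    integral_map (measurable_lin w).aemeasurable hf.aestronglyMeasurable]

lemma integrable_lin_data {f : ℝ → ℝ} (hf : ∀ m v, Integrable f (gaussianReal m v))
    (μ wstar w : Vec d) (σ : ℝ) :
    Integrable (fun x => f (lin w x)) (multivariateGaussian μ (dataCov wstar σ)) := by
  have := hf (inner ℝ w μ) (.mk ((σ * ‖suppProj wstar w‖) ^ 2) (sq_nonneg _))
  rw [← map_lin_data] at this
  exact this.comp_measurable (measurable_lin w)

/-- A coordinate off the support has mean and variance 0, so its law is the Dirac mass at 0. -/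
lemma ae_suppProj_data (μ wstar : Vec d) (hμ : suppProj wstar μ = μ) (σ : ℝ) :
    ∀ᵐ x ∂(multivariateGaussian μ (dataCov wstar σ)), suppProj wstar x = x := by
  have h : ∀ i, wstar i = 0 → ∀ᵐ x ∂(multivariateGaussian μ (dataCov wstar σ)), x i = 0 := by
    intro i hi
    have hm := map_lin_data μ wstar (EuclideanSpace.single i 1) σ
    have h0 : suppProj wstar (EuclideanSpace.single i (1 : ℝ)) = 0 := by
      ext j
      rcases eq_or_ne j i with rfl | hj
      · simp [hi]
      · simp [hj]
    have hv : (.mk ((σ * ‖suppProj wstar (EuclideanSpace.single i (1 : ℝ))‖) ^ 2) (sq_nonneg _) :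
        NNReal) = 0 := by
      rw [← NNReal.coe_eq_zero]; simp [h0]
    have hμi : inner ℝ (EuclideanSpace.single i (1 : ℝ)) μ = 0 := by
      rw [← hμ, ← inner_suppProj, h0, inner_zero_left]
    rw [hv, hμi, gaussianReal_zero_var] at hm
    have hae : ∀ᵐ t ∂(Measure.dirac (0 : ℝ)), t = 0 := by
      rw [ae_dirac_eq]; rfl
    rw [← hm] at hae
    filter_upwards [ae_of_ae_map (measurable_lin _).aemeasurable hae] with x hx
    simpa [lin, EuclideanSpace.inner_single_left] using hx
  have h' : ∀ i, ∀ᵐ x ∂(multivariateGaussian μ (dataCov wstar σ)), wstar i = 0 → x i = 0 := by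
    intro i
    by_cases hi : wstar i = 0
    · filter_upwards [h i hi] with x hx _ using hx
    · exact ae_of_all _ fun x h => absurd h hi
  filter_upwards [ae_all_iff.2 h'] with x hx
  ext i
  rw [suppProj_apply]
  split_ifs with hi
  · rfl
  · exact (hx i (not_not.1 hi)).symm

instance (wstar : Vec d) (σ : ℝ) : IsProbabilityMeasure (dataLaw wstar σ) := by
  constructor
  simp [dataLaw, ENNReal.inv_two_add_inv_two]

lemma dataLaw_eq (wstar : Vec d) (σ : ℝ) : dataLaw wstar σ =
    (2⁻¹ : ENNReal) • (multivariateGaussian wstar (dataCov wstar σ)).map (fun x => (x, (1 : ℝ))) +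
    (2⁻¹ : ENNReal) •
      (multivariateGaussian (-wstar) (dataCov wstar σ)).map (fun x => (x, (-1 : ℝ))) := by
  rw [dataLaw, Measure.prod_dirac, Measure.prod_dirac]

lemma ae_dataLaw {wstar : Vec d} {σ : ℝ} {p : Vec d × ℝ → Prop} (hp : MeasurableSet {x | p x})
    (h1 : ∀ᵐ x ∂(multivariateGaussian wstar (dataCov wstar σ)), p (x, 1))
    (h2 : ∀ᵐ x ∂(multivariateGaussian (-wstar) (dataCov wstar σ)), p (x, -1)) :
    ∀ᵐ x ∂(dataLaw wstar σ), p x := by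
  rw [dataLaw_eq, ae_add_measure_iff]
  constructor
  · exact Measure.ae_smul_measure ((ae_map_iff (by fun_prop) hp).2 h1) _
  · exact Measure.ae_smul_measure ((ae_map_iff (by fun_prop) hp).2 h2) _

lemma integral_dataLaw {wstar : Vec d} {σ : ℝ} {F : Vec d × ℝ → ℝ} (hF : Measurable F)
    (h1 : Integrable (fun x => F (x, 1)) (multivariateGaussian wstar (dataCov wstar σ)))
    (h2 : Integrable (fun x => F (x, -1)) (multivariateGaussian (-wstar) (dataCov wstar σ))) :
    ∫ p, F p ∂(dataLaw wstar σ) =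
      2⁻¹ * ∫ x, F (x, 1) ∂(multivariateGaussian wstar (dataCov wstar σ)) +
      2⁻¹ * ∫ x, F (x, -1) ∂(multivariateGaussian (-wstar) (dataCov wstar σ)) := by
  have m1 : AEMeasurable (fun x : Vec d => (x, (1 : ℝ)))
    (multivariateGaussian wstar (dataCov wstar σ)) := by fun_prop
  have m2 : AEMeasurable (fun x : Vec d => (x, (-1 : ℝ)))
    (multivariateGaussian (-wstar) (dataCov wstar σ)) := by fun_prop
  have i1 := (integrable_map_measure hF.aestronglyMeasurable m1).2 h1
  have i2 := (integrable_map_measure hF.aestronglyMeasurable m2).2 h2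
  rw [dataLaw_eq, integral_add_measure (i1.smul_measure (by simp)) (i2.smul_measure (by simp)),
    integral_smul_measure, integral_smul_measure, integral_map m1 hF.aestronglyMeasurable,
    integral_map m2 hF.aestronglyMeasurable]
  simp

lemma gaussAvg_neg_right (φ : ℝ → ℝ) (m s : ℝ) : gaussAvg φ m (-s) = gaussAvg φ m s := by
  have h : (gaussianReal 0 1).map (fun x => -x) = gaussianReal 0 1 := by
    rw [gaussianReal_map_neg, neg_zero]
  unfold gaussAvg
  nth_rewrite 2 [← h]
  rw [show (fun x : ℝ => -x) = MeasurableEquiv.neg ℝ from rfl, integral_map_equiv]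
  simp

/-- Along a ray the second argument changes sign with the scalar, whereas a standard deviation is
nonnegative. -/
lemma gaussAvg_abs_right (φ : ℝ → ℝ) (m s : ℝ) : gaussAvg φ m |s| = gaussAvg φ m s := by
  rcases abs_choice s with h | h <;> rw [h]
  exact gaussAvg_neg_right φ m s

/-! ### The surrogate risk and its minimizer -/

namespace IsConvexLoss

variable {φ : ℝ → ℝ} {p : ℝ}

/-- The two labels contribute equally, since y wᵀx has the same law given y = 1 and given y = -1. -/
lemma surrogateRisk_eq_integral (h : IsConvexLoss φ p) (wstar w : Vec d) (σ : ℝ) :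
    surrogateRisk (dataLaw wstar σ) φ w =
      ∫ x, φ (lin w x) ∂(multivariateGaussian wstar (dataCov wstar σ)) := by
  have hc := h.continuous
  have e : ∀ x : Vec d, (-1 : ℝ) * lin w x = lin (-w) x := fun x => by simp [lin]
  have i2 := integrable_lin_data h.integrable (-wstar) wstar (-w) σ
  have hm : Measurable fun p : Vec d × ℝ => φ (p.2 * lin w p.1) :=
    hc.measurable.comp (measurable_snd.mul ((measurable_lin w).comp measurable_fst))
  rw [surrogateRisk, integral_dataLaw hm
    (by simpa using integrable_lin_data h.integrable wstar wstar w σ) (by simpa only [e] using i2)]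
  simp only [one_mul, e]
  rw [integral_lin_data hc, integral_lin_data hc]
  simp
  ring

/-- The surrogate risk depends only on the mean and the standard deviation of the margin. -/
lemma surrogateRisk_eq (h : IsConvexLoss φ p) (wstar w : Vec d) (σ : ℝ) :
    surrogateRisk (dataLaw wstar σ) φ w =
      gaussAvg φ (inner ℝ w wstar) (σ * ‖suppProj wstar w‖) := by
  rw [h.surrogateRisk_eq_integral, integral_lin_data h.continuous]

lemma convexOn_surrogateRisk (h : IsConvexLoss φ p) (wstar : Vec d) (σ : ℝ) :
    ConvexOn ℝ Set.univ (surrogateRisk (dataLaw wstar σ) φ) := by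
  refine ⟨convex_univ, fun x _ y _ a b ha hb hab => ?_⟩
  have h1 := integrable_lin_data h.integrable wstar wstar x σ
  have h2 := integrable_lin_data h.integrable wstar wstar y σ
  simp only [h.surrogateRisk_eq_integral, smul_eq_mul]
  rw [← integral_const_mul, ← integral_const_mul, ← integral_add (h1.const_mul a) (h2.const_mul b)]
  refine integral_mono (integrable_lin_data h.integrable _ _ _ _)
    ((h1.const_mul a).add (h2.const_mul b)) fun z => ?_
  have := h.convex.2 (Set.mem_univ (lin x z)) (Set.mem_univ (lin y z)) ha hb hab
  simp only [smul_eq_mul] at this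
  refine le_trans (le_of_eq ?_) this
  congr 1
  simp [lin, inner_add_left, inner_smul_left]

lemma contDiffAt_surrogateRisk (h : IsConvexLoss φ p) (n : ℕ) {wstar w : Vec d} {σ : ℝ}
    (hσ : 0 < σ) (hw : suppProj wstar w ≠ 0) :
    ContDiffAt ℝ n (surrogateRisk (dataLaw wstar σ) φ) w := by
  rw [show surrogateRisk (dataLaw wstar σ) φ = fun w =>
    gaussAvg φ (inner ℝ w wstar) (σ * ‖suppProj wstar w‖) from
    funext fun w => h.surrogateRisk_eq wstar w σ]
  have h1 : ContDiffAt ℝ n (fun w : Vec d => (inner ℝ w wstar, σ * ‖suppProj wstar w‖)) w := by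
    refine ContDiffAt.prodMk (contDiffAt_id.inner ℝ contDiffAt_const) ?_
    exact contDiffAt_const.mul ((suppProj wstar).contDiff.contDiffAt.norm ℝ hw)
  exact ContDiffAt.comp (g := fun x : ℝ × ℝ => gaussAvg φ x.1 x.2) w
    (h.contDiffAt_gaussAvg n (inner ℝ w wstar) (mul_pos hσ (norm_pos_iff.2 hw))) h1

/-- The norm ‖suppProj wstar v‖ has a kink here, but the derivative of `gaussAvg φ` at the origin
ignores the deviation. The kink enters only through an error o(‖v - w‖). -/
lemma differentiableAt_surrogateRisk_of_suppProj_eq_zero (h : IsConvexLoss φ p) {wstar w : Vec d}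
    (σ : ℝ) (hw : suppProj wstar w = 0) :
    DifferentiableAt ℝ (surrogateRisk (dataLaw wstar σ) φ) w := by
  set k : Vec d → ℝ × ℝ := fun v => (inner ℝ v wstar, σ * ‖suppProj wstar v‖) with hk
  have hbig : (fun v => k v) =O[𝓝 w] fun v => v - w := by
    have h1 : (fun v : Vec d => inner ℝ (v - w) wstar) =O[𝓝 w] fun v => v - w :=
      Asymptotics.IsBigO.of_bound ‖wstar‖ (Eventually.of_forall fun v => by
        rw [mul_comm]; exact norm_inner_le_norm _ _)
    have h2 : (fun v : Vec d => σ * ‖suppProj wstar (v - w)‖) =O[𝓝 w] fun v => v - w :=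
      (((suppProj wstar).isBigO_sub (𝓝 w) w).norm_left.congr_left
        (fun v => by rw [map_sub])).const_mul_left σ
    refine (h1.prod_left h2).congr_left fun v => ?_
    have hin : inner ℝ w wstar = 0 := by rw [← inner_suppProj_self, hw, inner_zero_left]
    simp [hk, inner_sub_left, hin, hw]
  have hk0 : k w = 0 := by
    have hin : inner ℝ w wstar = 0 := by rw [← inner_suppProj_self, hw, inner_zero_left]
    simp [hk, hin, hw]
  have hkt : Tendsto k (𝓝 w) (𝓝 0) := by
    have : Continuous k := by
      rw [hk]
      exact (continuous_id.inner continuous_const).prodMk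
        (continuous_const.mul (suppProj wstar).continuous.norm)
    simpa [hk0] using this.tendsto w
  have hd := (hasFDerivAt_iff_isLittleO_nhds_zero.1 h.hasFDerivAt_gaussAvg_zero).comp_tendsto hkt
  have hd2 := hd.trans_isBigO hbig
  refine HasFDerivAt.differentiableAt (f' := p • innerSL ℝ wstar) ?_
  rw [hasFDerivAt_iff_isLittleO]
  exact hd2.congr_left (f₂ := fun v => surrogateRisk (dataLaw wstar σ) φ v -
    surrogateRisk (dataLaw wstar σ) φ w - (p • innerSL ℝ wstar) (v - w)) (fun v => by
      have hin : inner ℝ w wstar = 0 := by rw [← inner_suppProj_self, hw, inner_zero_left]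
      have hin' : inner ℝ wstar w = 0 := by rw [real_inner_comm, hin]
      simp [h.surrogateRisk_eq, hk, hin, hin', hw, inner_sub_right, real_inner_comm])

lemma differentiable_surrogateRisk (h : IsConvexLoss φ p) (wstar : Vec d) {σ : ℝ} (hσ : 0 < σ) :
    Differentiable ℝ (surrogateRisk (dataLaw wstar σ) φ) := by
  intro w
  by_cases hw : suppProj wstar w = 0
  · exact h.differentiableAt_surrogateRisk_of_suppProj_eq_zero σ hw
  · exact (h.contDiffAt_surrogateRisk 1 hσ hw).differentiableAt (by simp)

/-- On the coordinates where `wstar` does not vanish, the minimizer of the surrogate risk is unique,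
and it is a positive multiple of `wstar`. -/
lemma exists_isProjConvex (h : IsConvexLoss φ p) {wstar : Vec d} (h0 : wstar ≠ 0) {σ : ℝ}
    (hσ : 0 < σ) :
    ∃ c > 0, c ≤ φ 0 / (-p * ∫ z, max 0 (-(‖wstar‖ ^ 2 + σ * ‖wstar‖ * z)) ∂gaussianReal 0 1) ∧
      IsProjConvex (surrogateRisk (dataLaw wstar σ) φ) (suppProj wstar) (c • wstar) := by
  have hn : 0 < ‖wstar‖ := norm_pos_iff.2 h0
  obtain ⟨c, hc, hcle, huniq⟩ := h.exists_ray_min (α := ‖wstar‖ ^ 2) (β := σ * ‖wstar‖)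
    (by positivity) (by positivity)
  have hproj : suppProj wstar (c • wstar) = c • wstar := by rw [map_smul, suppProj_self]
  have hray : ∀ c' : ℝ, surrogateRisk (dataLaw wstar σ) φ (c' • wstar) =
      gaussAvg φ (c' * ‖wstar‖ ^ 2) (c' * (σ * ‖wstar‖)) := by
    intro c'
    rw [h.surrogateRisk_eq, inner_smul_left, real_inner_self_eq_norm_sq, map_smul, suppProj_self,
      norm_smul, Real.norm_eq_abs, ← gaussAvg_abs_right φ _ (c' * _), abs_mul c',
      abs_of_pos (mul_pos hσ hn)]
    congr 1
    ring
  refine ⟨c, hc, hcle, h.differentiable_surrogateRisk wstar hσ, h.convexOn_surrogateRisk wstar σ,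
    fun w => integral_nonneg fun _ => h.nonneg _, suppProj_idem wstar, inner_suppProj wstar,
    fun w => ?_, hproj, fun v hv hne => ?_, ?_⟩
  · rw [h.surrogateRisk_eq, h.surrogateRisk_eq, inner_suppProj_self, suppProj_idem]
  · set c' := inner ℝ v wstar / ‖wstar‖ ^ 2 with hc'
    have hin : inner ℝ v wstar = c' * ‖wstar‖ ^ 2 := by rw [hc']; field_simp
    by_cases hvc : v = c' • wstar
    · rw [hvc, hray, hray]
      refine huniq c' ?_
      rintro heq
      exact hne (by rw [hvc, heq])
    -- Off the ray, v has strictly larger norm than the multiple of `wstar` with the same mean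
    -- margin (Cauchy–Schwarz), hence a strictly larger deviation and risk.
    · have hlt : |c'| * ‖wstar‖ < ‖v‖ := by
        have h1 : 0 < ‖v - c' • wstar‖ ^ 2 := by
          have := norm_pos_iff.2 (sub_ne_zero.2 hvc)
          positivity
        rw [norm_sub_sq_real, inner_smul_right, hin, norm_smul, mul_pow, Real.norm_eq_abs,
          sq_abs] at h1
        refine lt_of_pow_lt_pow_left₀ 2 (norm_nonneg _) ?_
        rw [mul_pow, sq_abs]
        nlinarith
      have hge : surrogateRisk (dataLaw wstar σ) φ (c • wstar) ≤
          gaussAvg φ (c' * ‖wstar‖ ^ 2) (σ * (|c'| * ‖wstar‖)) := by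
        have e : σ * (|c'| * ‖wstar‖) = |c' * (σ * ‖wstar‖)| := by
          rw [abs_mul c', abs_of_pos (mul_pos hσ hn)]; ring
        rw [hray, e, gaussAvg_abs_right]
        by_cases hcc : c' = c
        · rw [hcc]
        · exact (huniq c' hcc).le
      refine hge.trans_lt ?_
      rw [h.surrogateRisk_eq, hv, hin]
      exact h.gaussAvg_lt_gaussAvg _ (by positivity) (by gcongr)
  · refine h.contDiffAt_surrogateRisk 2 hσ ?_
    rw [hproj]
    exact smul_ne_zero hc.ne' h0

end IsConvexLoss

/-! ### The Bayes risk -/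

lemma zeroOneLoss_one (a : ℝ) : zeroOneLoss a 1 = if 0 < a then 0 else 1 := by
  unfold zeroOneLoss sgn
  by_cases h : 0 < a <;> norm_num [h]

lemma zeroOneLoss_neg_one (a : ℝ) : zeroOneLoss a (-1) = if 0 < a then 1 else 0 := by
  unfold zeroOneLoss sgn
  by_cases h : 0 < a <;> norm_num [h]

lemma zeroOneLoss_mem (a y : ℝ) : zeroOneLoss a y = 0 ∨ zeroOneLoss a y = 1 := by
  unfold zeroOneLoss
  split_ifs <;> simp

lemma zeroOneLoss_nonneg (a y : ℝ) : 0 ≤ zeroOneLoss a y := by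
  rcases zeroOneLoss_mem a y with h | h <;> rw [h]; norm_num

lemma zeroOneLoss_le_one (a y : ℝ) : zeroOneLoss a y ≤ 1 := by
  rcases zeroOneLoss_mem a y with h | h <;> rw [h]; norm_num

lemma measurable_sgn : Measurable sgn :=
  Measurable.ite measurableSet_Ioi measurable_const measurable_const

lemma measurable_zeroOneLoss : Measurable fun p : ℝ × ℝ => zeroOneLoss p.1 p.2 :=
  Measurable.ite (measurableSet_eq_fun (measurable_sgn.comp measurable_fst) measurable_snd).compl
    measurable_const measurable_const

lemma integrable_zeroOneLoss {α : Type*} [MeasurableSpace α] {μ : Measure α} [IsFiniteMeasure μ]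
    {f g : α → ℝ} (hf : Measurable f) (hg : Measurable g) :
    Integrable (fun x => zeroOneLoss (f x) (g x)) μ :=
  Integrable.of_bound (measurable_zeroOneLoss.comp (hf.prodMk hg)).aestronglyMeasurable 1
    (ae_of_all _ fun x => by
      rw [Real.norm_eq_abs, abs_of_nonneg (zeroOneLoss_nonneg _ _)]
      exact zeroOneLoss_le_one _ _)

lemma risk01_dataLaw (wstar : Vec d) (σ : ℝ) {f : Vec d → ℝ} (hf : Measurable f) :
    risk01 (dataLaw wstar σ) f =
      2⁻¹ * ∫ x, zeroOneLoss (f x) 1 ∂(multivariateGaussian wstar (dataCov wstar σ)) +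
      2⁻¹ * ∫ x, zeroOneLoss (f x) (-1) ∂(multivariateGaussian (-wstar) (dataCov wstar σ)) := by
  rw [risk01, integral_dataLaw (F := fun p : Vec d × ℝ => zeroOneLoss (f p.1) p.2)
    (measurable_zeroOneLoss.comp ((hf.comp measurable_fst).prodMk measurable_snd))
    (integrable_zeroOneLoss hf measurable_const) (integrable_zeroOneLoss hf measurable_const)]

/-- The vector with component `t` along the unit vector `e` and the same component as `v`
orthogonal to `e`. -/
def replaceComponent (e : Vec d) (q : ℝ × Vec d) : Vec d :=
  q.1 • e + (q.2 - (inner ℝ e q.2 : ℝ) • e)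

lemma continuous_replaceComponent (e : Vec d) : Continuous (replaceComponent e) := by
  unfold replaceComponent; fun_prop

/-- On the support the covariance is isotropic, so the component along e is independent of the
orthogonal one. Only the former depends on a. -/
lemma multivariateGaussian_eq_map_replaceComponent {wstar e : Vec d} (he : ‖e‖ = 1)
    (hPe : suppProj wstar e = e) (σ a : ℝ) :
    multivariateGaussian (a • e) (dataCov wstar σ) =
      ((gaussianReal a (.mk (σ ^ 2) (sq_nonneg σ))).prod
        (multivariateGaussian 0 (dataCov wstar σ))).map (replaceComponent e) := by
  have hm := (continuous_replaceComponent e).measurable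
  have : IsProbabilityMeasure (((gaussianReal a (.mk (σ ^ 2) (sq_nonneg σ))).prod
        (multivariateGaussian 0 (dataCov wstar σ))).map (replaceComponent e)) :=
    Measure.isProbabilityMeasure_map hm.aemeasurable
  refine Measure.ext_of_charFun (funext fun s => ?_)
  rw [charFun_data, charFun_apply, integral_map hm.aemeasurable
    (Continuous.aestronglyMeasurable (by fun_prop))]
  set k : ℝ := inner ℝ e s with hk
  have hin : ∀ q : ℝ × Vec d, Complex.exp ((inner ℝ (replaceComponent e q) s : ℝ) * Complex.I) =
      Complex.exp (k * q.1 * Complex.I) *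
        Complex.exp ((inner ℝ q.2 (s - k • e) : ℝ) * Complex.I) := by
    intro q
    rw [← Complex.exp_add, ← add_mul, replaceComponent, inner_add_left, inner_sub_left,
      inner_smul_left, inner_smul_left, inner_sub_right, inner_smul_right, real_inner_comm e q.2,
      ← hk]
    push_cast
    simp only [conj_trivial]
    congr 2
    ring
  simp_rw [hin]
  rw [integral_prod_mul (fun t : ℝ => Complex.exp (k * t * Complex.I))
      (fun v : Vec d => Complex.exp ((inner ℝ v (s - k • e) : ℝ) * Complex.I)),
    ← charFun_apply_real, ← charFun_apply, charFun_gaussianReal, charFun_data, ← Complex.exp_add]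
  congr 1
  have hnorm : ‖suppProj wstar (s - k • e)‖ ^ 2 = ‖suppProj wstar s‖ ^ 2 - k ^ 2 := by
    have hks : inner ℝ (suppProj wstar s) e = k := by
      rw [inner_suppProj, hPe, real_inner_comm]
    rw [map_sub, map_smul, hPe, norm_sub_sq_real, inner_smul_right, hks, norm_smul, he,
      mul_one, Real.norm_eq_abs, sq_abs]
    ring
  rw [mul_pow σ ‖suppProj wstar (s - k • e)‖, hnorm, inner_smul_right, real_inner_comm, ← hk,
    inner_zero_right]
  simp only [NNReal.coe_mk]
  push_cast
  ring

/-- The two normal densities with means `a` and `-a` are best separated at the origin. -/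
lemma gaussian_risk_le {a σ : ℝ} (ha : 0 ≤ a) (hσ : 0 < σ) {h : ℝ → ℝ} (hh : Measurable h) :
    ∫ t, zeroOneLoss t 1 ∂gaussianReal a (.mk (σ ^ 2) (sq_nonneg σ)) +
      ∫ t, zeroOneLoss t (-1) ∂gaussianReal (-a) (.mk (σ ^ 2) (sq_nonneg σ)) ≤
    ∫ t, zeroOneLoss (h t) 1 ∂gaussianReal a (.mk (σ ^ 2) (sq_nonneg σ)) +
      ∫ t, zeroOneLoss (h t) (-1) ∂gaussianReal (-a) (.mk (σ ^ 2) (sq_nonneg σ)) := by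
  have hv : (.mk (σ ^ 2) (sq_nonneg σ) : NNReal) ≠ 0 := by
    rw [← NNReal.coe_ne_zero]
    exact (pow_pos hσ 2).ne'
  set v : NNReal := .mk (σ ^ 2) (sq_nonneg σ)
  have hint : ∀ (b y : ℝ) (g : ℝ → ℝ), Measurable g →
      Integrable fun t => gaussianPDFReal b v t • zeroOneLoss (g t) y := by
    intro b y g hg
    refine (integrable_gaussianPDFReal b v).mono'
      ((measurable_gaussianPDFReal b v).mul (measurable_zeroOneLoss.comp
        (hg.prodMk measurable_const))).aestronglyMeasurable (ae_of_all _ fun t => ?_)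
    rw [norm_smul, Real.norm_eq_abs, Real.norm_eq_abs, abs_of_nonneg (gaussianPDFReal_nonneg _ _ _),
      abs_of_nonneg (zeroOneLoss_nonneg _ _)]
    exact mul_le_of_le_one_right (gaussianPDFReal_nonneg _ _ _) (zeroOneLoss_le_one _ _)
  have hid : ∀ b y : ℝ, Integrable fun t => gaussianPDFReal b v t • zeroOneLoss t y :=
    fun b y => hint b y _ measurable_id
  simp_rw [integral_gaussianReal_eq_integral_smul hv]
  rw [← integral_add (hid _ _) (hid _ _),
    ← integral_add (hint _ _ _ hh) (hint _ _ _ hh)]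
  refine integral_mono ((hid _ _).add (hid _ _))
    ((hint _ _ _ hh).add (hint _ _ _ hh)) fun t => ?_
  have hmono : ∀ b c : ℝ, (t - b) ^ 2 ≤ (t - c) ^ 2 →
      gaussianPDFReal c v t ≤ gaussianPDFReal b v t := by
    intro b c hbc
    unfold gaussianPDFReal
    gcongr
  simp only [zeroOneLoss_one, zeroOneLoss_neg_one, smul_eq_mul]
  have h1 := gaussianPDFReal_nonneg a v t
  have h2 := gaussianPDFReal_nonneg (-a) v t
  rcases lt_or_ge 0 t with ht | ht
  · have := hmono a (-a) (by nlinarith)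
    rw [if_pos ht, if_pos ht]
    split_ifs <;> linarith
  · have := hmono (-a) a (by nlinarith)
    rw [if_neg (not_lt.2 ht), if_neg (not_lt.2 ht)]
    split_ifs <;> linarith

section

variable {wstar : Vec d} {σ : ℝ}

lemma risk01_eq_integral_replaceComponent (h0 : wstar ≠ 0) {f : Vec d → ℝ} (hf : Measurable f) :
    risk01 (dataLaw wstar σ) f = 2⁻¹ * ∫ v,
      (∫ t, zeroOneLoss (f (replaceComponent (‖wstar‖⁻¹ • wstar) (t, v))) 1
          ∂gaussianReal ‖wstar‖ (.mk (σ ^ 2) (sq_nonneg σ)) +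
        ∫ t, zeroOneLoss (f (replaceComponent (‖wstar‖⁻¹ • wstar) (t, v))) (-1)
          ∂gaussianReal (-‖wstar‖) (.mk (σ ^ 2) (sq_nonneg σ)))
      ∂(multivariateGaussian 0 (dataCov wstar σ)) := by
  have hn : 0 < ‖wstar‖ := norm_pos_iff.2 h0
  set e := ‖wstar‖⁻¹ • wstar with he
  have he1 : ‖e‖ = 1 := by rw [he, norm_smul, norm_inv, norm_norm, inv_mul_cancel₀ hn.ne']
  have hPe : suppProj wstar e = e := by rw [he, map_smul, suppProj_self]
  have hw : wstar = ‖wstar‖ • e := by rw [he, smul_smul, mul_inv_cancel₀ hn.ne', one_smul]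
  have hm := (continuous_replaceComponent e).measurable
  have key : ∀ (b y : ℝ), ∫ x, zeroOneLoss (f x) y ∂(multivariateGaussian (b • e) (dataCov wstar σ)) =
      ∫ v, ∫ t, zeroOneLoss (f (replaceComponent e (t, v))) y
        ∂gaussianReal b (.mk (σ ^ 2) (sq_nonneg σ)) ∂(multivariateGaussian 0 (dataCov wstar σ)) := by
    intro b y
    rw [multivariateGaussian_eq_map_replaceComponent he1 hPe, integral_map hm.aemeasurable
      (integrable_zeroOneLoss hf measurable_const).aestronglyMeasurable]
    exact integral_prod_symm _ (integrable_zeroOneLoss (hf.comp hm) measurable_const)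
  have hi : ∀ (b y : ℝ), Integrable (fun v => ∫ t, zeroOneLoss (f (replaceComponent e (t, v))) y
        ∂gaussianReal b (.mk (σ ^ 2) (sq_nonneg σ))) (multivariateGaussian 0 (dataCov wstar σ)) :=
    fun b y => (integrable_zeroOneLoss (hf.comp hm) (measurable_const (a := y))).integral_prod_right
  rw [risk01_dataLaw wstar σ hf, integral_add (hi _ _) (hi _ _), ← key, ← key, neg_smul, ← hw,
    mul_add]

lemma lin_replaceComponent (h0 : wstar ≠ 0) (q : ℝ × Vec d) :
    lin wstar (replaceComponent (‖wstar‖⁻¹ • wstar) q) = ‖wstar‖ * q.1 := by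
  have hn : ‖wstar‖ ≠ 0 := norm_ne_zero_iff.2 h0
  simp only [lin, replaceComponent, inner_add_right, inner_sub_right, inner_smul_right,
    inner_smul_left, real_inner_self_eq_norm_sq, conj_trivial]
  field_simp
  ring

lemma zeroOneLoss_mul {c : ℝ} (hc : 0 < c) (a y : ℝ) :
    zeroOneLoss (c * a) y = zeroOneLoss a y := by
  unfold zeroOneLoss sgn
  simp only [mul_pos_iff_of_pos_left hc]

/-- The component of x orthogonal to `wstar` has the same law under both labels. With it frozen, f
is a rule on the line and `gaussian_risk_le` applies. -/
lemma risk01_lin_le (h0 : wstar ≠ 0) (hσ : 0 < σ) {f : Vec d → ℝ} (hf : Measurable f) :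
    risk01 (dataLaw wstar σ) (lin wstar) ≤ risk01 (dataLaw wstar σ) f := by
  have hn : 0 < ‖wstar‖ := norm_pos_iff.2 h0
  have hm := (continuous_replaceComponent (‖wstar‖⁻¹ • wstar)).measurable
  rw [risk01_eq_integral_replaceComponent h0 (measurable_lin wstar),
    risk01_eq_integral_replaceComponent h0 hf]
  simp only [lin_replaceComponent h0, zeroOneLoss_mul hn]
  have hi : ∀ (b y : ℝ), Integrable (fun v => ∫ t,
      zeroOneLoss (f (replaceComponent (‖wstar‖⁻¹ • wstar) (t, v))) y
        ∂gaussianReal b (.mk (σ ^ 2) (sq_nonneg σ))) (multivariateGaussian 0 (dataCov wstar σ)) :=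
    fun b y => (integrable_zeroOneLoss (hf.comp hm) (measurable_const (a := y))).integral_prod_right
  refine mul_le_mul_of_nonneg_left (integral_mono (integrable_const _) ((hi _ _).add (hi _ _))
    fun v => ?_) (by norm_num)
  exact gaussian_risk_le hn.le hσ (hf.comp (hm.comp (by fun_prop)))

lemma bayesRisk_eq (h0 : wstar ≠ 0) (hσ : 0 < σ) :
    bayesRisk (dataLaw wstar σ) = risk01 (dataLaw wstar σ) (lin wstar) := by
  have : Nonempty {f : Vec d → ℝ // Measurable f} := ⟨⟨_, measurable_lin wstar⟩⟩
  refine le_antisymm ?_ (le_ciInf fun f => risk01_lin_le h0 hσ f.2)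
  exact ciInf_le ⟨0, by
    rintro _ ⟨f, rfl⟩
    exact integral_nonneg fun _ => zeroOneLoss_nonneg _ _⟩
    (⟨_, measurable_lin wstar⟩ : {f : Vec d → ℝ // Measurable f})

lemma lin_add_of_suppProj {x : Vec d} (hx : suppProj wstar x = x) (c : ℝ) (w₀ : Vec d) :
    lin (c • wstar + (w₀ - suppProj wstar w₀)) x = c * lin wstar x := by
  have : inner ℝ (w₀ - suppProj wstar w₀) x = 0 := by
    rw [inner_sub_left, inner_suppProj, hx, sub_self]
  simp [lin, inner_add_left, inner_smul_left, this]

lemma ae_dataLaw_suppProj (wstar : Vec d) (σ : ℝ) :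
    ∀ᵐ p ∂(dataLaw wstar σ), suppProj wstar p.1 = p.1 := by
  have hcl : MeasurableSet {p : Vec d × ℝ | suppProj wstar p.1 = p.1} :=
    (isClosed_eq ((suppProj wstar).continuous.comp continuous_fst) continuous_fst).measurableSet
  exact ae_dataLaw hcl (ae_suppProj_data _ _ (suppProj_self wstar) σ)
    (ae_suppProj_data _ _ (by rw [map_neg, suppProj_self]) σ)

/-- Coordinates outside the support of the data do not affect the 0/1 risk. -/
lemma risk01_lin_add_sub_bayesRisk (h0 : wstar ≠ 0) (hσ : 0 < σ) {c : ℝ} (hc : 0 < c)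
    (w₀ : Vec d) :
    risk01 (dataLaw wstar σ) (lin (c • wstar + (w₀ - suppProj wstar w₀))) -
      bayesRisk (dataLaw wstar σ) = 0 := by
  rw [bayesRisk_eq h0 hσ, sub_eq_zero]
  refine integral_congr_ae ?_
  filter_upwards [ae_dataLaw_suppProj wstar σ] with p hp
  simp only [lin_add_of_suppProj hp, zeroOneLoss_mul hc]

end

/-! ### The adversarial risk -/

lemma integral_sq_stdNormal : ∫ z : ℝ, z ^ 2 ∂gaussianReal 0 1 = 1 := by
  have h := variance_fun_id_gaussianReal (μ := 0) (v := 1)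
  rw [variance_eq_integral (by fun_prop), integral_id_gaussianReal] at h
  simpa using h

lemma integrable_sq_gaussianReal (m : ℝ) (v : NNReal) :
    Integrable (fun z : ℝ => z ^ 2) (gaussianReal m v) :=
  (memLp_id_gaussianReal 2).integrable_sq

lemma gaussAvg_sq (m s : ℝ) : gaussAvg (fun t => t ^ 2) m s = m ^ 2 + s ^ 2 := by
  have h1 : Integrable (fun z : ℝ => m ^ 2 + 2 * m * s * z) (gaussianReal 0 1) :=
    (integrable_const _).add (integrable_id_stdNormal.const_mul _)
  have h2 : Integrable (fun z : ℝ => s ^ 2 * z ^ 2) (gaussianReal 0 1) :=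
    (integrable_sq_gaussianReal 0 1).const_mul _
  have e : ∀ z : ℝ, (m + s * z) ^ 2 = (m ^ 2 + 2 * m * s * z) + s ^ 2 * z ^ 2 := fun z => by ring
  simp_rw [gaussAvg, e]
  rw [integral_add h1 h2, integral_affine_stdNormal, integral_const_mul, integral_sq_stdNormal,
    mul_one]

lemma integrable_sq_lin_dataLaw (wstar : Vec d) (σ : ℝ) :
    Integrable (fun p : Vec d × ℝ => lin wstar p.1 ^ 2) (dataLaw wstar σ) := by
  have h := fun μ : Vec d => integrable_lin_data integrable_sq_gaussianReal μ wstar wstar σ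
  have hm' : Measurable (fun p : Vec d × ℝ => lin wstar p.1 ^ 2) :=
    ((measurable_lin wstar).comp measurable_fst).pow_const 2
  rw [dataLaw_eq]
  refine Integrable.add_measure (Integrable.smul_measure ?_ (by simp))
    (Integrable.smul_measure ?_ (by simp))
  · exact (integrable_map_measure hm'.aestronglyMeasurable (by fun_prop)).2 (h wstar)
  · exact (integrable_map_measure hm'.aestronglyMeasurable (by fun_prop)).2 (h (-wstar))

lemma integral_sq_lin_dataLaw (wstar : Vec d) (σ : ℝ) :
    ∫ p, lin wstar p.1 ^ 2 ∂(dataLaw wstar σ) = ‖wstar‖ ^ 4 + σ ^ 2 * ‖wstar‖ ^ 2 := by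
  have h := fun μ : Vec d => integrable_lin_data integrable_sq_gaussianReal μ wstar wstar σ
  have hc : Continuous fun t : ℝ => t ^ 2 := by fun_prop
  rw [integral_dataLaw (F := fun p : Vec d × ℝ => lin wstar p.1 ^ 2)
    (((measurable_lin wstar).comp measurable_fst).pow_const 2) (h _) (h _)]
  simp only
  rw [integral_lin_data hc, integral_lin_data hc, gaussAvg_sq, gaussAvg_sq, suppProj_self,
    inner_neg_right, real_inner_self_eq_norm_sq]
  ring

section Perturbation

variable {wstar ξ : Vec d}

lemma abs_inner_le_of_abs_le {ε : ℝ} {w δ : Vec d} (hδ : ∀ i, |δ i| ≤ ε) :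
    |inner ℝ w δ| ≤ ε * ∑ i, |w i| := by
  rw [PiLp.inner_apply, Finset.mul_sum]
  refine (Finset.abs_sum_le_sum_abs _ _).trans (Finset.sum_le_sum fun i _ => ?_)
  simp only [RCLike.inner_apply, conj_trivial, abs_mul]
  exact mul_le_mul_of_nonneg_right (hδ i) (abs_nonneg _)

lemma sum_abs_pos (h0 : wstar ≠ 0) : 0 < ∑ i, |wstar i| := by
  obtain ⟨i, hi⟩ : ∃ i, wstar i ≠ 0 := by
    by_contra! h
    exact h0 (by ext i; simpa using h i)
  exact Finset.sum_pos' (fun i _ => abs_nonneg _) ⟨i, Finset.mem_univ _, abs_pos.2 hi⟩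

/-- Bounded perturbations realize all admissible shifts along two vectors with disjoint supports. -/
lemma exists_perturbation (h0 : wstar ≠ 0) (hξ : suppProj wstar ξ = 0) {ε : ℝ} (hε : 0 < ε)
    {s τ : ℝ} (hs : |s| ≤ ε * ∑ i, |wstar i|) (hτ : |τ| ≤ 1) :
    ∃ δ : Vec d, (∀ i, |δ i| ≤ ε) ∧ inner ℝ wstar δ = s ∧
      inner ℝ ξ δ = τ * (ε * ∑ i, |ξ i|) := by
  have hpos := sum_abs_pos h0
  set e := ε * ∑ i, |wstar i| with he
  have hepos : 0 < e := mul_pos hε hpos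
  have hsign : ∀ x : ℝ, |(SignType.sign x : ℝ)| ≤ 1 := by
    intro x
    rcases lt_trichotomy x 0 with h | h | h <;> simp [h]
  have hself : ∀ x : ℝ, (SignType.sign x : ℝ) * x = |x| := fun x => sign_mul_self x
  have hξi : ∀ i, wstar i ≠ 0 → ξ i = 0 := by
    intro i hi
    have := congrArg (fun v : Vec d => v i) hξ
    simpa [hi] using this
  -- The extremal sign vector of each ℓ¹ norm, scaled down on each support separately.
  refine ⟨WithLp.toLp 2 fun i => if wstar i ≠ 0 then s / e * ε * SignType.sign (wstar i)
    else τ * ε * SignType.sign (ξ i), fun i => ?_, ?_, ?_⟩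
  · have hse : |s / e| ≤ 1 := by
      rw [abs_div, abs_of_pos hepos]
      exact (div_le_one hepos).2 hs
    simp only
    split_ifs with hi
    · rw [abs_mul, abs_mul, abs_of_pos hε]
      calc |s / e| * ε * |(SignType.sign (wstar i) : ℝ)| ≤ 1 * ε * 1 := by
            gcongr; exact hsign _
        _ = ε := by ring
    · rw [abs_mul, abs_mul, abs_of_pos hε]
      calc |τ| * ε * |(SignType.sign (ξ i) : ℝ)| ≤ 1 * ε * 1 := by
            gcongr; exact hsign _
        _ = ε := by ring
  · calc _ = ∑ i, s / e * ε * |wstar i| := by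
          rw [PiLp.inner_apply]
          refine Finset.sum_congr rfl fun i _ => ?_
          simp only [RCLike.inner_apply, conj_trivial]
          split_ifs with hi
          · rw [mul_assoc, hself]
          · rw [not_not.1 hi]; simp
      _ = s := by
          rw [← Finset.mul_sum, mul_assoc, ← he]
          field_simp
  · calc _ = ∑ i, τ * ε * |ξ i| := by
          rw [PiLp.inner_apply]
          refine Finset.sum_congr rfl fun i _ => ?_
          simp only [RCLike.inner_apply, conj_trivial]
          split_ifs with hi
          · rw [hξi i hi]; simp
          · rw [mul_assoc, hself]
      _ = _ := by rw [← Finset.mul_sum, mul_assoc]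

end Perturbation

/-- The scores whose predicted sign can be flipped by an adversary that moves the score of the base
classifier by at most `e` without changing its sign, and the offset of the attacked classifier by
at most `b`. -/
def flippable (c e b : ℝ) : Set ℝ :=
  {t | (0 < t ∧ c * (t - e) ≤ b) ∨ (t ≤ 0 ∧ 0 < c * (t + e) + b)}

lemma measurableSet_flippable (c e b : ℝ) : MeasurableSet (flippable c e b) := by
  unfold flippable
  measurability

/-- The score moves toward 0 without changing sign, and the offset is used in full. Since `sgn 0 =
-1`, a nonpositive score may move to 0, but a positive one must stay positive: hence the clamp `max
(t - e) (min t (b / c))`. -/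
lemma exists_shift_of_mem_flippable {c e b t : ℝ} (hc : 0 < c) (he : 0 ≤ e) (hb : 0 < b)
    (ht : t ∈ flippable c e b) :
    ∃ s τ : ℝ, |s| ≤ e ∧ |τ| ≤ 1 ∧ sgn t = sgn (t + s) ∧ sgn (c * (t + s) + τ * b) ≠ sgn t := by
  have hbc : 0 < b / c := div_pos hb hc
  rcases ht with ⟨h0, h1⟩ | ⟨h0, h1⟩
  · have h2 : t - e ≤ b / c := by rw [le_div_iff₀ hc]; linarith
    have h3 : 0 < max (t - e) (min t (b / c)) := lt_max_of_lt_right (lt_min h0 hbc)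
    have h4 : max (t - e) (min t (b / c)) ≤ b / c := max_le h2 (min_le_right _ _)
    have h5 : max (t - e) (min t (b / c)) ≤ t := max_le (by linarith) (min_le_left _ _)
    refine ⟨max (t - e) (min t (b / c)) - t, -1, ?_, by simp, ?_, ?_⟩
    · rw [abs_le]
      constructor <;> linarith [le_max_left (t - e) (min t (b / c))]
    · rw [add_sub_cancel, sgn, sgn, if_pos h0, if_pos h3]
    · rw [add_sub_cancel, sgn, sgn, if_pos h0, if_neg]
      · norm_num
      · rw [le_div_iff₀ hc] at h4
        linarith
  · have h2 : -(b / c) < t + e := by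
      rw [neg_lt_iff_pos_add, ← mul_pos_iff_of_pos_left hc, mul_add, mul_div_cancel₀ _ hc.ne']
      exact h1
    have h3 : -(b / c) < min (t + e) 0 := lt_min h2 (by linarith)
    have h5 : t ≤ min (t + e) 0 := le_min (by linarith) h0
    refine ⟨min (t + e) 0 - t, 1, ?_, by simp, ?_, ?_⟩
    · rw [abs_le]
      constructor <;> linarith [min_le_left (t + e) 0]
    · rw [add_sub_cancel, sgn, sgn, if_neg (not_lt.2 h0), if_neg (not_lt.2 (min_le_right _ _))]
    · rw [add_sub_cancel, sgn, sgn, if_neg (not_lt.2 h0), if_pos]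
      · norm_num
      · rw [neg_lt_iff_pos_add, ← mul_pos_iff_of_pos_left hc, mul_add,
          mul_div_cancel₀ _ hc.ne'] at h3
        linarith

lemma mem_flippable_of_shift {c e b t s r : ℝ} (hc : 0 < c) (hs : |s| ≤ e) (hr : |r| ≤ b)
    (h2 : sgn (c * (t + s) + r) ≠ sgn t) : t ∈ flippable c e b := by
  rw [abs_le] at hs hr
  unfold sgn at h2
  by_cases h0 : 0 < t
  · left
    refine ⟨h0, ?_⟩
    rw [if_pos h0] at h2
    have h3 : ¬ 0 < c * (t + s) + r := fun h => h2 (if_pos h)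
    nlinarith
  · right
    refine ⟨not_lt.1 h0, ?_⟩
    rw [if_neg h0] at h2
    have h3 : 0 < c * (t + s) + r := by
      by_contra h
      exact h2 (if_neg h)
    nlinarith

/-- Pointwise form of Chebyshev's inequality: the offset alone flips every score with |t| < b / c.
-/
lemma one_sub_sq_le_indicator {c e b t : ℝ} (hc : 0 < c) (he : 0 ≤ e) (hb : 0 < b) :
    1 - t ^ 2 / (b / c) ^ 2 ≤ (flippable c e b).indicator (fun _ => (1 : ℝ)) t := by
  have hbc : 0 < b / c := div_pos hb hc
  by_cases ht : t ∈ flippable c e b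
  · rw [Set.indicator_of_mem ht]
    have : 0 ≤ t ^ 2 / (b / c) ^ 2 := by positivity
    linarith
  · rw [Set.indicator_of_notMem ht, sub_nonpos, one_le_div (by positivity)]
    refine (sq_le_sq₀ hbc.le (abs_nonneg t)).2 ?_ |>.trans (sq_abs t).le
    simp only [flippable, Set.mem_ofPred_eq, not_or, not_and, not_le, not_lt] at ht
    rw [div_le_iff₀ hc]
    rcases lt_or_ge 0 t with h0 | h0
    · have := ht.1 h0
      rw [abs_of_pos h0]
      nlinarith
    · have := ht.2 h0
      rw [abs_of_nonpos h0]
      nlinarith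

section

variable {wstar : Vec d} {σ : ℝ}

/-- The attacked classifier agrees with the base classifier at x, so the subtracted loss is 0. The
exact value identifies the integrand with a measurable function of the score, as needed to bound its
integral from below. -/
lemma sSup_adversary_eq (h0 : wstar ≠ 0) {c : ℝ} (hc : 0 < c) (w₀ : Vec d) {ε : ℝ} (hε : 0 < ε)
    (hb : 0 < ∑ i, |(w₀ - suppProj wstar w₀) i|) {x : Vec d} (hx : suppProj wstar x = x) :
    sSup {v : ℝ | ∃ δ : Vec d, (∀ i, |δ i| ≤ ε) ∧
        sgn (lin wstar x) = sgn (lin wstar (x + δ)) ∧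
        v = zeroOneLoss (lin (c • wstar + (w₀ - suppProj wstar w₀)) (x + δ)) (sgn (lin wstar x)) -
          zeroOneLoss (lin (c • wstar + (w₀ - suppProj wstar w₀)) x) (sgn (lin wstar x))} =
      (flippable c (ε * ∑ i, |wstar i|) (ε * ∑ i, |(w₀ - suppProj wstar w₀) i|)).indicator
        (fun _ => (1 : ℝ)) (lin wstar x) := by
  set ξ := w₀ - suppProj wstar w₀ with hξdef
  have hξ : suppProj wstar ξ = 0 := by rw [hξdef, map_sub, suppProj_idem, sub_self]
  have hξx : inner ℝ ξ x = 0 := by rw [← hx, ← inner_suppProj, hξ, inner_zero_left]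
  set t := lin wstar x with ht
  have hlin : ∀ δ, lin wstar (x + δ) = t + inner ℝ wstar δ := fun δ => by
    rw [ht, lin, lin, inner_add_right]
  have hlin' : ∀ δ, lin (c • wstar + ξ) (x + δ) = c * (t + inner ℝ wstar δ) + inner ℝ ξ δ := by
    intro δ
    rw [← hlin]
    simp only [lin, inner_add_left, inner_smul_left, conj_trivial]
    rw [inner_add_right ξ, hξx, zero_add]
  have hz : zeroOneLoss (lin (c • wstar + ξ) x) (sgn t) = 0 := by
    have : lin (c • wstar + ξ) x = c * t := by
      have := hlin' 0
      simpa using this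
    rw [this, zeroOneLoss_mul hc]
    simp [zeroOneLoss]
  have heps : 0 ≤ ε * ∑ i, |wstar i| := (mul_pos hε (sum_abs_pos h0)).le
  simp only [hlin, hlin', hz, sub_zero]
  by_cases hmem : t ∈ flippable c (ε * ∑ i, |wstar i|) (ε * ∑ i, |ξ i|)
  · rw [Set.indicator_of_mem hmem]
    obtain ⟨s, τ, hs, hτ, h1, h2⟩ := exists_shift_of_mem_flippable hc heps (mul_pos hε hb) hmem
    obtain ⟨δ, hδ, hδ1, hδ2⟩ := exists_perturbation h0 hξ hε hs hτ
    refine IsGreatest.csSup_eq ⟨⟨δ, hδ, by rw [hδ1]; exact h1, ?_⟩, ?_⟩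
    · rw [hδ1, hδ2, zeroOneLoss, if_pos h2]
    · rintro v ⟨δ, -, -, rfl⟩
      exact zeroOneLoss_le_one _ _
  · rw [Set.indicator_of_notMem hmem]
    have hall : ∀ δ : Vec d, (∀ i, |δ i| ≤ ε) →
        zeroOneLoss (c * (t + inner ℝ wstar δ) + inner ℝ ξ δ) (sgn t) = 0 := by
      intro δ hδ
      rw [zeroOneLoss, if_neg]
      intro h2
      exact hmem (mem_flippable_of_shift hc (abs_inner_le_of_abs_le hδ) (abs_inner_le_of_abs_le hδ)
        h2)
    refine IsGreatest.csSup_eq ⟨⟨0, fun i => by simpa using hε.le, by simp, ?_⟩, ?_⟩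
    · exact (hall 0 fun i => by simpa using hε.le).symm
    · rintro v ⟨δ, hδ, -, rfl⟩
      exact (hall δ hδ).le

/-- The adversarial risk is large once the `ℓ¹` norm of the component of the classifier outside the
support of the data, scaled by the budget, dominates the typical score. -/
lemma le_advRisk01 (h0 : wstar ≠ 0) {c : ℝ} (hc : 0 < c) (w₀ : Vec d) {ε : ℝ}
    (hε : 0 < ε) (hb : 0 < ∑ i, |(w₀ - suppProj wstar w₀) i|)
    (hbig : c ^ 2 * (20 * (‖wstar‖ ^ 4 + σ ^ 2 * ‖wstar‖ ^ 2)) ≤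
      (ε * ∑ i, |(w₀ - suppProj wstar w₀) i|) ^ 2) :
    0.95 ≤ advRisk01 (dataLaw wstar σ) (fun x => sgn (lin wstar x)) ε
      (lin (c • wstar + (w₀ - suppProj wstar w₀))) := by
  set b := ε * ∑ i, |(w₀ - suppProj wstar w₀) i| with hbdef
  set e := ε * ∑ i, |wstar i| with hedef
  have hbpos : 0 < b := mul_pos hε hb
  have hepos : 0 < e := mul_pos hε (sum_abs_pos h0)
  have heq : advRisk01 (dataLaw wstar σ) (fun x => sgn (lin wstar x)) ε
      (lin (c • wstar + (w₀ - suppProj wstar w₀))) =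
      ∫ p, (flippable c e b).indicator (fun _ => (1 : ℝ)) (lin wstar p.1) ∂(dataLaw wstar σ) := by
    refine integral_congr_ae ?_
    filter_upwards [ae_dataLaw_suppProj wstar σ] with p hp
    exact sSup_adversary_eq h0 hc w₀ hε hb hp
  have hmeas : Measurable fun p : Vec d × ℝ =>
      (flippable c e b).indicator (fun _ => (1 : ℝ)) (lin wstar p.1) :=
    (measurable_const.indicator (measurableSet_flippable c e b)).comp
      ((measurable_lin wstar).comp measurable_fst)
  have hint : Integrable (fun p : Vec d × ℝ =>
      (flippable c e b).indicator (fun _ => (1 : ℝ)) (lin wstar p.1)) (dataLaw wstar σ) :=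
    Integrable.of_bound hmeas.aestronglyMeasurable 1 (ae_of_all _ fun p => by
      refine (norm_indicator_le_norm_self _ _).trans ?_
      simp)
  have hsq := integrable_sq_lin_dataLaw wstar σ
  have hle : ∫ p, (1 - lin wstar p.1 ^ 2 / (b / c) ^ 2) ∂(dataLaw wstar σ) ≤
      ∫ p, (flippable c e b).indicator (fun _ => (1 : ℝ)) (lin wstar p.1) ∂(dataLaw wstar σ) :=
    integral_mono ((integrable_const _).sub (hsq.div_const _)) hint fun p =>
      one_sub_sq_le_indicator hc hepos.le hbpos
  rw [integral_sub (integrable_const _) (hsq.div_const _), integral_div,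
    integral_sq_lin_dataLaw] at hle
  rw [heq]
  refine le_trans ?_ hle
  -- The numerator is the second moment of the score; the factor 20 in `hbig` leaves 1 - 1/20 =
  -- 0.95.
  have h1 : (‖wstar‖ ^ 4 + σ ^ 2 * ‖wstar‖ ^ 2) / (b / c) ^ 2 ≤ 1 / 20 := by
    rw [div_pow, div_div_eq_mul_div, div_le_div_iff₀ (by positivity) (by norm_num)]
    linarith
  simp
  linarith

end

/-! ### The random initialization -/

lemma posSemidef_smul_one (d : ℕ) {v : ℝ} (hv : 0 ≤ v) :
    (v • (1 : Matrix (Fin d) (Fin d) ℝ)).PosSemidef :=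
  Matrix.PosSemidef.one.smul hv

/-- The initialization is a scaling of a vector of independent standard normal variables. -/
lemma initLaw_eq_map_pi (d m : ℕ) :
    initLaw d m = (Measure.pi fun _ : Fin d => gaussianReal 0 1).map
      (fun z => Real.sqrt (1 / Real.sqrt m) • (WithLp.toLp 2 z : Vec d)) := by
  have hv : 0 ≤ 1 / Real.sqrt m := by positivity
  have hcomp : (fun z : Fin d → ℝ => Real.sqrt (1 / Real.sqrt m) • (WithLp.toLp 2 z : Vec d)) =
      (fun x : Vec d => Real.sqrt (1 / Real.sqrt m) • x) ∘ (WithLp.toLp 2) := rfl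
  rw [hcomp, ← Measure.map_map (by fun_prop) (by fun_prop), map_pi_eq_stdGaussian, initLaw]
  have : IsProbabilityMeasure ((stdGaussian (Vec d)).map
    (fun x : Vec d => Real.sqrt (1 / Real.sqrt m) • x)) :=
    Measure.isProbabilityMeasure_map (by fun_prop)
  refine Measure.ext_of_charFun (funext fun t => ?_)
  rw [charFun_multivariateGaussian (posSemidef_smul_one d hv), charFun_map_smul,
    charFun_stdGaussian, norm_smul, ← Complex.ofReal_pow, mul_pow, Real.norm_eq_abs, sq_abs, Real.sq_sqrt hv,
    inner_zero_right, Matrix.smul_mulVec, Matrix.one_mulVec, dotProduct_smul, smul_eq_mul,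
    EuclideanSpace.real_norm_sq_eq]
  congr 1
  simp only [dotProduct, ← sq]
  push_cast
  ring

lemma integrable_exp_neg_abs : Integrable (fun z : ℝ => Real.exp (-|z|)) (gaussianReal 0 1) :=
  Integrable.of_bound (by fun_prop) 1 (ae_of_all _ fun z => by simp [Real.abs_exp])

lemma integral_exp_neg_abs_lt_one : ∫ z, Real.exp (-|z|) ∂gaussianReal 0 1 < 1 := by
  by_contra! hge
  have hz := eq_zero_of_gaussian_integral_nonpos (f := fun z => 1 - Real.exp (-|z|)) (by fun_prop)
    (fun z => by simp) ((integrable_const _).sub integrable_exp_neg_abs) (by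
      rw [integral_sub (integrable_const _) integrable_exp_neg_abs]
      simpa using hge) 1
  simp only [abs_one, sub_eq_zero] at hz
  exact (Real.exp_lt_one_iff.2 (by norm_num : (-1 : ℝ) < 0)).ne' hz

lemma integral_exp_neg_abs_pos : 0 < ∫ z, Real.exp (-|z|) ∂gaussianReal 0 1 :=
  integral_exp_pos integrable_exp_neg_abs

/-- Exponential Markov bound for the `ℓ¹` norm of a subvector of independent standard normals. -/
lemma pi_real_sum_abs_le (s : Finset (Fin d)) (T : ℝ) :
    (Measure.pi fun _ : Fin d => gaussianReal 0 1).real {z | ∑ i ∈ s, |z i| ≤ T} ≤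
      Real.exp T * (∫ z, Real.exp (-|z|) ∂gaussianReal 0 1) ^ s.card := by
  set μ := Measure.pi fun _ : Fin d => gaussianReal 0 1
  -- Factors 1 outside s let the product run over all coordinates, as independence under
  -- `Measure.pi` requires.
  set g : Fin d → ℝ → ℝ := fun i z => if i ∈ s then Real.exp (-|z|) else 1 with hg
  have hgi : ∀ i, Integrable (g i) (gaussianReal 0 1) := by
    intro i
    simp only [hg]
    split_ifs
    · exact integrable_exp_neg_abs
    · exact integrable_const _
  have hprod : ∫ z, ∏ i, g i (z i) ∂μ = (∫ z, Real.exp (-|z|) ∂gaussianReal 0 1) ^ s.card := by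
    rw [integral_fintype_prod_eq_prod]
    have : ∀ i, ∫ z, g i z ∂gaussianReal 0 1 =
        if i ∈ s then ∫ z, Real.exp (-|z|) ∂gaussianReal 0 1 else 1 := by
      intro i
      simp only [hg]
      split_ifs <;> simp
    simp only [this]
    rw [Finset.prod_ite_mem, Finset.univ_inter, Finset.prod_const]
  have hi : Integrable (fun z : Fin d → ℝ => ∏ i, g i (z i)) μ := Integrable.fintype_prod hgi
  have hms : MeasurableSet {z : Fin d → ℝ | ∑ i ∈ s, |z i| ≤ T} :=
    measurableSet_le (by fun_prop) measurable_const
  rw [← hprod, ← integral_const_mul, ← integral_indicator_one hms]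
  refine integral_mono ((integrable_const (1 : ℝ)).indicator hms) (hi.const_mul _) fun z => ?_
  have he : ∏ i, g i (z i) = Real.exp (-∑ i ∈ s, |z i|) := by
    simp only [hg]
    rw [Finset.prod_ite_mem, Finset.univ_inter, ← Real.exp_sum, Finset.sum_neg_distrib]
  simp only [he]
  rw [← Real.exp_add]
  by_cases hz : z ∈ {z : Fin d → ℝ | ∑ i ∈ s, |z i| ≤ T}
  · rw [Set.indicator_of_mem hz]
    have : ∑ i ∈ s, |z i| ≤ T := hz
    exact Real.one_le_exp (by linarith)
  · rw [Set.indicator_of_notMem hz]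
    positivity

lemma card_zero_coords (wstar : Vec d) :
    (Finset.univ.filter fun i => wstar i = 0).card = d - nnz wstar := by
  have h := Finset.card_filter_add_card_filter_not (s := (Finset.univ : Finset (Fin d)))
    (fun i => wstar i = 0)
  have h2 : nnz wstar = (Finset.univ.filter fun i => ¬ wstar i = 0).card := by
    rw [nnz, ← Set.ncard_coe_finset]
    congr 1
    ext i; simp
  simp only [Finset.card_univ, Fintype.card_fin] at h
  omega

lemma sum_abs_sub_suppProj (wstar w : Vec d) :
    ∑ i, |(w - suppProj wstar w) i| = ∑ i ∈ Finset.univ.filter fun i => wstar i = 0, |w i| := by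
  rw [Finset.sum_filter]
  refine Finset.sum_congr rfl fun i _ => ?_
  by_cases hi : wstar i = 0 <;> simp [hi]

/-- The `ℓ¹` norm of the initialization off the support of `wstar` exceeds `K √m` with probability
exponentially close to one. -/
lemma initLaw_real_sum_abs_le (wstar : Vec d) (K : ℝ) {m : ℕ} (hm : m = d - nnz wstar)
    (hpos : 0 < m) :
    (initLaw d m).real {w | ∑ i, |(w - suppProj wstar w) i| ≤ K * Real.sqrt m} ≤
      Real.exp (K * Real.sqrt (Real.sqrt m) ^ 3) *
        (∫ z, Real.exp (-|z|) ∂gaussianReal 0 1) ^ m := by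
  have hm0 : (0 : ℝ) < m := by exact_mod_cast hpos
  have hx : 0 < Real.sqrt (Real.sqrt m) := Real.sqrt_pos.2 (Real.sqrt_pos.2 hm0)
  have hms : MeasurableSet {w : Vec d | ∑ i, |(w - suppProj wstar w) i| ≤ K * Real.sqrt m} := by
    simp only [sum_abs_sub_suppProj]
    exact (isClosed_le (by fun_prop) continuous_const).measurableSet
  have hcard : (Finset.univ.filter fun i => wstar i = 0).card = m := by rw [card_zero_coords, hm]
  refine le_trans (le_of_eq ?_) ((pi_real_sum_abs_le (Finset.univ.filter fun i => wstar i = 0)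
    (K * Real.sqrt (Real.sqrt m) ^ 3)).trans_eq (by rw [hcard]))
  rw [initLaw_eq_map_pi, map_measureReal_apply (by fun_prop) hms]
  congr 1
  ext z
  simp only [Set.mem_preimage, Set.mem_ofPred_eq, sum_abs_sub_suppProj]
  -- The coordinates have standard deviation m^(-1/4), so the threshold K m^(1/2) becomes K m^(3/4)
  -- for standard normals.
  have hs : Real.sqrt (1 / Real.sqrt m) = (Real.sqrt (Real.sqrt m))⁻¹ := by
    rw [one_div, Real.sqrt_inv]
  have he : ∑ i ∈ Finset.univ.filter (fun i => wstar i = 0),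
      |(Real.sqrt (1 / Real.sqrt m) • (WithLp.toLp 2 z : Vec d)) i| =
      (Real.sqrt (Real.sqrt m))⁻¹ * ∑ i ∈ Finset.univ.filter (fun i => wstar i = 0), |z i| := by
    rw [Finset.mul_sum]
    refine Finset.sum_congr rfl fun i _ => ?_
    rw [hs]
    simp [abs_mul, abs_of_pos hx]
  rw [he, inv_mul_le_iff₀ hx]
  have h3 : Real.sqrt (Real.sqrt m) * (K * Real.sqrt m) = K * Real.sqrt (Real.sqrt m) ^ 3 := by
    nth_rewrite 2 [← Real.sq_sqrt (Real.sqrt_nonneg (m : ℝ))]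
    ring
  rw [h3]

/-- With x = m^(1/4) the exponent is K x³ + x⁴ log q, and log q < 0. -/
lemma tendsto_exp_mul_pow (K : ℝ) {q : ℝ} (hq0 : 0 < q) (hq1 : q < 1) :
    Tendsto (fun m : ℕ => Real.exp (K * Real.sqrt (Real.sqrt m) ^ 3) * q ^ m) atTop (𝓝 0) := by
  have hL : 0 < -Real.log q := by linarith [Real.log_neg hq0 hq1]
  have hx : Tendsto (fun m : ℕ => Real.sqrt (Real.sqrt (m : ℝ))) atTop atTop :=
    Real.tendsto_sqrt_atTop.comp (Real.tendsto_sqrt_atTop.comp tendsto_natCast_atTop_atTop)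
  have hpoly : Tendsto (fun x : ℝ => x ^ 3 * (-Real.log q * x + -K)) atTop atTop :=
    (tendsto_pow_atTop (by norm_num)).atTop_mul_atTop₀
      (tendsto_atTop_add_const_right _ _ (tendsto_id.const_mul_atTop hL))
  have hexp := Real.tendsto_exp_atBot.comp (tendsto_neg_atTop_atBot.comp (hpoly.comp hx))
  refine hexp.congr fun m => ?_
  have h4 : Real.sqrt (Real.sqrt (m : ℝ)) ^ 4 = m := by
    rw [show (4 : ℕ) = 2 * 2 from rfl, pow_mul, Real.sq_sqrt (Real.sqrt_nonneg _),
      Real.sq_sqrt (Nat.cast_nonneg m)]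
  have hqm : q ^ m = Real.exp (m * Real.log q) := by
    rw [mul_comm, Real.exp_mul, Real.exp_log hq0, Real.rpow_natCast]
  rw [hqm, ← Real.exp_add]
  simp only [Function.comp]
  congr 1
  nth_rewrite 4 [← h4]
  ring

instance (d m : ℕ) : IsProbabilityMeasure (initLaw d m) := by
  unfold initLaw; infer_instance

lemma one_sub_le_measureReal {α : Type*} [MeasurableSpace α] {μ : Measure α}
    [IsProbabilityMeasure μ] {s t : Set α} {τ : ℝ} (hs : μ.real s ≤ τ)
    (hst : ∀ x, x ∉ s → x ∈ t) : 1 - τ ≤ μ.real t := by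
  have hcover : Set.univ ⊆ s ∪ t := fun x _ => or_iff_not_imp_left.2 (hst x)
  have h1 := (measureReal_mono (μ := μ) hcover).trans (measureReal_union_le _ _)
  rw [probReal_univ] at h1
  linarith

/-- The mean of the negative part of the margin of a classifier of norm between `C` and `M`. -/
lemma mul_negPart_le {a σ C M : ℝ} (hC : 0 < C) (hCa : C ≤ a) (haM : a ≤ M) :
    C * ∫ z, max 0 (-(M + σ * z)) ∂gaussianReal 0 1 ≤
      ∫ z, max 0 (-(a ^ 2 + σ * a * z)) ∂gaussianReal 0 1 := by
  rw [← integral_const_mul]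
  refine integral_mono ((IsConvexLoss.integrable_negPart _ _).const_mul C)
    (IsConvexLoss.integrable_negPart _ _) fun z => ?_
  have ha : 0 < a := hC.trans_le hCa
  have e : -(a ^ 2 + σ * a * z) = a * -(a + σ * z) := by ring
  have e2 : max 0 (a * -(a + σ * z)) = a * max 0 (-(a + σ * z)) := by
    rw [mul_max_of_nonneg _ _ ha.le, mul_zero]
  simp only [e, e2]
  gcongr

end AdvRisk

end

/-! ### The main theorem -/

theorem theorem7
    (φ : ℝ → ℝ) (hφ_nonneg : ∀ t, 0 ≤ φ t) (hφ_convex : ConvexOn ℝ Set.univ φ)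
    (hφ_cal : AdvRisk.IsCalibrated φ)
    (hφ_int : ∀ (μ : ℝ) (v : NNReal),
      MeasureTheory.Integrable φ (ProbabilityTheory.gaussianReal μ v))
    (σ : ℝ) (hσ : 0 < σ) (C M : ℝ) (hC : 0 < C) (τ : ℝ) (hτ : 0 < τ) :
    ∃ N : ℕ, ∀ (d k : ℕ) (wstar : AdvRisk.Vec d),
      AdvRisk.nnz wstar = k → k + N ≤ d → C ≤ ‖wstar‖ → ‖wstar‖ ≤ M →
        Differentiable ℝ (AdvRisk.surrogateRisk (AdvRisk.dataLaw wstar σ) φ) ∧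
        ∃ wGD : AdvRisk.Vec d → AdvRisk.Vec d,
          (∀ B : ℝ, ∃ η₀ : ℝ, 0 < η₀ ∧ ∀ η : ℝ, 0 < η → η < η₀ →
            ∀ w₀ : AdvRisk.Vec d, ‖w₀‖ ≤ B →
              Filter.Tendsto
                (AdvRisk.gradDescent
                  (AdvRisk.surrogateRisk (AdvRisk.dataLaw wstar σ) φ) η w₀)
                Filter.atTop (nhds (wGD w₀))) ∧
          1 - τ ≤ (AdvRisk.initLaw d (d - k)).real
            {w₀ | AdvRisk.risk01 (AdvRisk.dataLaw wstar σ) (AdvRisk.lin (wGD w₀))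
                    - AdvRisk.bayesRisk (AdvRisk.dataLaw wstar σ) = 0 ∧
                  ∀ ε : ℝ, 2 * ‖wstar‖ ^ 2 / Real.sqrt ((d : ℝ) - (k : ℝ)) ≤ ε →
                    0.95 ≤ AdvRisk.advRisk01 (AdvRisk.dataLaw wstar σ)
                      (fun x => AdvRisk.sgn (AdvRisk.lin wstar x)) ε
                      (AdvRisk.lin (wGD w₀))} := by
  open AdvRisk MeasureTheory ProbabilityTheory in
  obtain ⟨p, h⟩ := hφ_cal.exists_isConvexLoss hφ_nonneg hφ_convex hφ_int
  have hp := h.deriv_neg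
  set κ := ∫ z, max 0 (-(M + σ * z)) ∂gaussianReal 0 1
  have hκ : 0 < κ := IsConvexLoss.negPart_pos hσ.ne'
  -- An upper bound for the multiple c of `wstar` in the limit, uniform over C ≤ ‖wstar‖ ≤ M and
  -- over the dimension.
  set cmax := φ 0 / (-p * (C * κ)) with hcmax
  have hcmax0 : 0 ≤ cmax :=
    div_nonneg (h.nonneg 0) (mul_nonneg (by linarith) (mul_pos hC hκ).le)
  set A := Real.sqrt (20 * (M ^ 4 + σ ^ 2 * M ^ 2)) with hA
  -- Chosen so that ε ≥ 2 ‖wstar‖² / √m and an off-support ℓ¹ norm above K √m give ε ‖ξ‖₁ ≥ cmax A,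
  -- where A² is 20 times the largest possible second moment of the score.
  set K := cmax * A / (2 * C ^ 2) with hK
  have hK0 : 0 ≤ K := by positivity
  obtain ⟨N, hN⟩ := ((tendsto_exp_mul_pow K integral_exp_neg_abs_pos
    integral_exp_neg_abs_lt_one).eventually (Iio_mem_nhds hτ)).exists_forall_of_atTop
  -- The extra 1 ensures d - k > 0, so that √m can be divided by.
  refine ⟨N + 1, fun d k wstar hk hkd hCw hwM => ?_⟩
  have hw : 0 < ‖wstar‖ := hC.trans_le hCw
  have h0 : wstar ≠ 0 := norm_pos_iff.1 hw
  obtain ⟨c, hc, hcle, hproj⟩ := h.exists_isProjConvex h0 hσ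
  refine ⟨hproj.differentiable, fun w₀ => c • wstar + (w₀ - suppProj wstar w₀),
    hproj.tendsto_gradDescent, ?_⟩
  set m := d - k with hm
  have hmpos : 0 < m := by omega
  have hcast : (d : ℝ) - (k : ℝ) = m := by rw [hm, Nat.cast_sub (by omega)]
  have hbad := (initLaw_real_sum_abs_le wstar K (m := m) (by rw [hk]) hmpos).trans
    (hN m (by omega)).le
  have hccmax : c ≤ cmax := by
    refine hcle.trans ?_
    rw [hcmax]
    have := mul_negPart_le (σ := σ) hC hCw hwM
    refine div_le_div_of_nonneg_left (h.nonneg 0)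
      (mul_pos (by linarith) (mul_pos hC hκ)) ?_
    exact mul_le_mul_of_nonneg_left this (by linarith)
  refine one_sub_le_measureReal hbad fun w₀ hw₀ =>
    ⟨risk01_lin_add_sub_bayesRisk h0 hσ hc w₀, fun ε hε => ?_⟩
  rw [Set.mem_ofPred_eq, not_le] at hw₀
  rw [hcast] at hε
  set S := ∑ i, |(w₀ - suppProj wstar w₀) i|
  have hsq : 0 < Real.sqrt m := Real.sqrt_pos.2 (by exact_mod_cast hmpos)
  have hε0 : 0 < ε := lt_of_lt_of_le (by positivity) hε
  have hS : 0 < S := lt_of_le_of_lt (by positivity) hw₀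
  refine le_advRisk01 h0 hc w₀ hε0 hS ?_
  have h1 : c * A ≤ ε * S :=
    calc c * A ≤ cmax * A := by gcongr
      _ = 2 * C ^ 2 * K := by rw [hK]; field_simp
      _ ≤ 2 * ‖wstar‖ ^ 2 * K := by gcongr
      _ = 2 * ‖wstar‖ ^ 2 / Real.sqrt m * (K * Real.sqrt m) := by field_simp
      _ ≤ ε * S := by gcongr
  calc c ^ 2 * (20 * (‖wstar‖ ^ 4 + σ ^ 2 * ‖wstar‖ ^ 2))
      ≤ c ^ 2 * (20 * (M ^ 4 + σ ^ 2 * M ^ 2)) := by gcongr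
    _ = (c * A) ^ 2 := by rw [mul_pow, hA, Real.sq_sqrt (by positivity)]
    _ ≤ (ε * S) ^ 2 := by gcongr
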